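/- Let $\mathbb F$ be a field of characteristic $0$; vector spaces, spans and Lie superalgebras are over $\mathbb F$, and Lie algebras are the Lie superalgebras with zero odd part. For a vector space $U$, a $U$-valued formal distribution is a series $a(z)=\sum_{n\in\mathbb Z}a_{(n)}z^{-n-1}$ with $a_{(n)}\in U$; $c(z,w)\in U[[z^{\pm1},w^{\pm1}]]$ is local if $(z-w)^Nc(z,w)=0$ for some $N\ge 0$. Distributions $a(z),b(z)$ with values in a Lie superalgebra, or in $\operatorname{End}V$ for a superspace $V$, form a local pair if $[a(z),b(w)]$ is local; in $\operatorname{End}V$, $[\cdot,\cdot]$ is the supercommutator. Let $(\mathfrak g,\mathcal F_0)$ be a regular formal distribution Lie superalgebra. That is, $\mathfrak g=\mathfrak g_{\bar0}\oplus\mathfrak g_{\bar1}$ is a Lie superalgebra and $\mathcal F_0=\{a^j(z)\}_{j\in J}$ is a family of pairwise local homogeneous (all $a^j_{(n)}$, $n\in\mathbb Z$, of the same parity) $\mathfrak g$-valued formal distributions whose coefficients $a^j_{(n)}$ span $\mathfrak g$, such that * the $\mathbb F[\partial_z]$-span of $\mathcal F_0$ is closed under the products $a(z)_{(n)}b(z)=\operatorname{Res}\,(w-z)^n[a(w),b(z)]\,dw$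 for all integers $n\ge0$; * there is a derivation $T$ of $\mathfrak g$ with $T(a^j_{(n)})=-n\,a^j_{(n-1)}$ for all $j\in J$, $n\in\mathbb Z$. Let $\mathfrak g_-=\operatorname{span}\{a^j_{(n)}\mid j\in J,\ n\ge0\}$ be the annihilation subalgebra, $V=U(\mathfrak g)/U(\mathfrak g)\mathfrak g_-$ with the $\mathbb Z/2\mathbb Z$-grading induced from $\mathfrak g$, $|0\rangle\in V$ the image of $1$, $\pi$ the representation of $\mathfrak g$ in $V$ by left multiplication, $T\in\operatorname{End}V$ the endomorphism induced by the derivation $T$ of $\mathfrak g$ (extended to a derivation of $U(\mathfrak g)$), and $\mathcal F=\{\pi(a^j(z))=\sum_n\pi(a^j_{(n)})z^{-n-1}\}_{j\in J}$. **Theorem 2.1.** Every member of $\mathcal F$ is a quantum field, i.e. for each $v\in V$ one has $\pi(a^j_{(n)})v=0$ for all sufficiently large $n$. Moreover, $(V,|0\rangle,T,\mathcal F)$ satisfies the hypotheses of the Extension theorem: $V$ is a superspace, $|0\rangle$ is non-zero and even, $T$ is even, the members of $\mathcal F$ are homogeneous, and 1. $T|0\rangle=0$; 2. $[T,\pi(a^j(z))]=\partial_z\pi(a^j(z))$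 for all $j\in J$; 3. $(z-w)^{N_{ij}}[\pi(a^i(z)),\pi(a^j(w))]=0$ for all $i,j\in J$, with some integers $N_{ij}\ge 0$; 4. the vectors $\pi(a^{j_1}_{(n_1)})\cdots\pi(a^{j_s}_{(n_s)})|0\rangle$, with $s\ge0$, $j_i\in J$, $n_i\in\mathbb Z$, span $V$. Hence $V$ is a vertex (super)algebra with vacuum vector $|0\rangle$ and translation operator $T$: there is a parity preserving linear map $v\mapsto v(z)=\sum_n v_{(n)}z^{-n-1}$ from $V$ to the $\operatorname{End}V$-valued quantum fields such that $|0\rangle(z)=I_V$, $v(z)|0\rangle=v+(Tv)z+\cdots\in V[[z]]$, $[T,v(z)]=\partial_zv(z)=(Tv)(z)$, and $u(z),v(z)$ is a local pair, for all $u,v\in V$. Its image is the set $\mathcal F_{\max}$ of all quantum fields $b(z)$ with $[T,b(z)]=\partial_zb(z)$ that form a local pair with every $\pi(a^j(z))$, and it extends $\mathcal F$: the field of the vector $\pi(a^j_{(-1)})|0\rangle$ is $\pi(a^j(z))$ for all $j\in J$. -/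

import Mathlib

/-! ### Formal distributions

A `U`-valued formal distribution `a(z) = ∑ₙ a₍ₙ₎ z^{-n-1}` is given by its coefficients
`a : ℤ → U`, `n ↦ a₍ₙ₎`; a distribution in two variables
`c(z,w) = ∑ c₍ₘ₎₍ₙ₎ z^{-m-1} w^{-n-1}` by `c : ℤ → ℤ → U`. -/

namespace FormalDistribution

/-- Multiplication of `c(z,w)` by `z - w`. (Multiplying by `z` shifts `m` to `m + 1`.) -/
def mulSub {U : Type*} [AddCommGroup U] (c : ℤ → ℤ → U) : ℤ → ℤ → U :=
  fun m n => c (m + 1) n - c m (n + 1)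

/-- `(z-w)^N c(z,w) = 0` for some `N ∈ ℤ₊`. -/
def IsLocal {U : Type*} [AddCommGroup U] (c : ℤ → ℤ → U) : Prop :=
  ∃ N : ℕ, mulSub^[N] c = 0

/-- The derivative `∂_z a(z)`, i.e. `(∂a)₍ₙ₎ = -n a₍ₙ₋₁₎`. -/
def dz {U : Type*} [AddCommGroup U] (a : ℤ → U) : ℤ → U :=
  fun n => -(n • a (n - 1))

/-- The `𝔽[∂_z]`-span of a family of formal distributions: all finite sums
`∑ⱼ fⱼ(∂_z) aʲ(z)` with `fⱼ` polynomials with coefficients in `𝔽`. -/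
def derivSpan (F : Type*) {U J : Type*} [Field F] [AddCommGroup U] [Module F U]
    (a : J → ℤ → U) : Submodule F (ℤ → U) :=
  Submodule.span F (Set.range fun q : J × ℕ => dz^[q.2] (a q.1))

end FormalDistribution

/-- The sign `(-1)^{ij}` for parities `i, j ∈ ℤ/2ℤ`. -/
def superSign (i j : ZMod 2) : ℤ := if i = 1 ∧ j = 1 then -1 else 1

/-! ### Lie superalgebras -/

/-- A Lie superalgebra structure on the vector space `g` over `F` (of characteristic zero in all
uses); `part i` is the subspace of elements of parity `i`. Lie algebras are the case
`part 1 = ⊥`. -/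
structure LieSuperalgebra (F g : Type*) [Field F] [AddCommGroup g] [Module F g] where
  part : ZMod 2 → Submodule F g
  isCompl : IsCompl (part 0) (part 1)
  bracket : g →ₗ[F] g →ₗ[F] g
  bracket_mem : ∀ i j x y, x ∈ part i → y ∈ part j → bracket x y ∈ part (i + j)
  skew : ∀ i j x y, x ∈ part i → y ∈ part j → bracket x y = -(superSign i j • bracket y x)
  jacobi : ∀ i j x y z, x ∈ part i → y ∈ part j →
    bracket x (bracket y z) = bracket (bracket x y) z + superSign i j • bracket y (bracket x z)

namespace LieSuperalgebra

open FormalDistribution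

section

variable {F g : Type*} [Field F] [AddCommGroup g] [Module F g] (L : LieSuperalgebra F g)

/-- An (even) derivation of a Lie superalgebra. -/
structure IsDerivation (T : g →ₗ[F] g) : Prop where
  even : ∀ i x, x ∈ L.part i → T x ∈ L.part i
  leibniz : ∀ x y, T (L.bracket x y) = L.bracket (T x) y + L.bracket x (T y)

/-- The `n`-th product `a(z)₍ₙ₎b(z) = Res (w-z)ⁿ [a(w), b(z)] dw`, `n ∈ ℤ₊`. The residue in the
first variable is the coefficient with index `0`. -/
def nthProduct (n : ℕ) (a b : ℤ → g) : ℤ → g :=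
  fun k => (mulSub^[n] fun m l => L.bracket (a m) (b l)) 0 k

/-- `(g, {aʲ(z)}_{j ∈ J})` is a formal distribution Lie superalgebra: the `aʲ(z)` are homogeneous
(all coefficients of `aʲ(z)` have one and the same parity), pairwise local, and their coefficients
span `g`. -/
structure IsFormalDistribution {J : Type*} (a : J → ℤ → g) : Prop where
  homogeneous : ∀ j, ∃ p, ∀ n, a j n ∈ L.part p
  isLocal : ∀ i j, IsLocal fun m n => L.bracket (a i m) (a j n)
  span_eq_top : Submodule.span F (Set.range fun q : J × ℤ => a q.1 q.2) = ⊤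

/-- `T` is a derivation of `g` such that `T(aʲ(z)) = ∂_z aʲ(z)` for all `j`. -/
structure IsTranslation {J : Type*} (a : J → ℤ → g) (T : g →ₗ[F] g) : Prop where
  isDerivation : L.IsDerivation T
  map_coeff : ∀ j, (fun n => T (a j n)) = dz (a j)

/-- Regular formal distribution Lie superalgebras. -/
structure IsRegular {J : Type*} (a : J → ℤ → g) : Prop extends L.IsFormalDistribution a where
  nthProduct_mem : ∀ (n : ℕ) (b c : ℤ → g), b ∈ derivSpan F a → c ∈ derivSpan F a →
    L.nthProduct n b c ∈ derivSpan F a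
  exists_translation : ∃ T, L.IsTranslation a T

/-- The annihilation subalgebra `g₋ = span {aʲ₍ₙ₎ | j ∈ J, n ∈ ℤ₊}`. -/
def annihilation (F : Type*) {g J : Type*} [Field F] [AddCommGroup g] [Module F g]
    (a : J → ℤ → g) : Submodule F g :=
  Submodule.span F (Set.range fun q : J × ℕ => a q.1 q.2)

/-! ### The universal enveloping algebra -/

/-- The relations `xy = (-1)^{p(x)p(y)} yx + [x,y]`. -/
inductive EnvRel : TensorAlgebra F g → TensorAlgebra F g → Prop
  | of (i j : ZMod 2) (x y : g) (hx : x ∈ L.part i) (hy : y ∈ L.part j) :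
      EnvRel (TensorAlgebra.ι F x * TensorAlgebra.ι F y)
        (superSign i j • (TensorAlgebra.ι F y * TensorAlgebra.ι F x) +
          TensorAlgebra.ι F (L.bracket x y))

/-- The universal enveloping algebra `U(g)`: the tensor algebra modulo the relations `EnvRel`. -/
abbrev Env : Type _ := RingQuot L.EnvRel

/-- The canonical map `g → U(g)`. -/
def ι : g →ₗ[F] L.Env :=
  (RingQuot.mkAlgHom F L.EnvRel).toLinearMap.comp (TensorAlgebra.ι F)

theorem ι_mul_ι (i j : ZMod 2) (x y : g) (hx : x ∈ L.part i) (hy : y ∈ L.part j) :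
    L.ι x * L.ι y = superSign i j • (L.ι y * L.ι x) + L.ι (L.bracket x y) := by
  have h := RingQuot.mkAlgHom_rel F (EnvRel.of (L := L) i j x y hx hy)
  simp only [map_mul, map_add, map_zsmul] at h
  exact h

/-- The universal property of `U(g)`. -/
def lift {A : Type*} [Ring A] [Algebra F A] (f : g →ₗ[F] A)
    (hf : ∀ i j x y, x ∈ L.part i → y ∈ L.part j →
      f x * f y = superSign i j • (f y * f x) + f (L.bracket x y)) : L.Env →ₐ[F] A :=
  RingQuot.liftAlgHom F ⟨TensorAlgebra.lift F f, by
    rintro _ _ ⟨i, j, x, y, hx, hy⟩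
    simpa only [map_mul, map_add, map_zsmul, TensorAlgebra.lift_ι_apply] using hf i j x y hx hy⟩

@[simp]
theorem lift_ι {A : Type*} [Ring A] [Algebra F A] (f : g →ₗ[F] A)
    (hf : ∀ i j x y, x ∈ L.part i → y ∈ L.part j →
      f x * f y = superSign i j • (f y * f x) + f (L.bracket x y)) (x : g) :
    L.lift f hf (L.ι x) = f x := by
  simp [lift, ι]

theorem env_hom_ext {A : Type*} [Ring A] [Algebra F A] {f f' : L.Env →ₐ[F] A}
    (h : ∀ x, f (L.ι x) = f' (L.ι x)) : f = f' := by
  apply RingQuot.ringQuot_ext'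
  apply TensorAlgebra.hom_ext
  ext x
  exact h x

/-- The subspace of elements of parity `i` of `U(g)`: the span of the products `x₁ ⋯ xₛ` of
homogeneous elements of `g` with `p(x₁) + ⋯ + p(xₛ) = i`. -/
def envPart (i : ZMod 2) : Submodule F L.Env :=
  Submodule.span F {u | ∃ l : List (ZMod 2 × g), (∀ q ∈ l, q.2 ∈ L.part q.1) ∧
    (l.map Prod.fst).sum = i ∧ u = (l.map fun q => L.ι q.2).prod}

/-- The algebra homomorphism `u ↦ u + ε D(u)`, where `D` is the derivation of `U(g)` that extends
the derivation `T` of `g`. -/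
def envDualHom (T : g →ₗ[F] g) (hT : L.IsDerivation T) : L.Env →ₐ[F] DualNumber L.Env :=
  L.lift
    { toFun := fun x => TrivSqZeroExt.inl (L.ι x) + TrivSqZeroExt.inr (L.ι (T x))
      map_add' := fun x y => by ext <;> simp
      map_smul' := fun c x => by ext <;> simp }
    (by
      intro i j x y hx hy
      ext
      · simpa using L.ι_mul_ι i j x y hx hy
      · have h1 := L.ι_mul_ι i j (T x) y (hT.even i x hx) hy
        have h2 := L.ι_mul_ι i j x (T y) hx (hT.even j y hy)
        simp [hT.leibniz, h1, h2, mul_add]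
        abel)

/-- The derivation of `U(g)` that extends the derivation `T` of `g`
(characterized by `envDerivation_ι` and `envDerivation_mul`). -/
def envDerivation (T : g →ₗ[F] g) (hT : L.IsDerivation T) : L.Env →ₗ[F] L.Env :=
  (TrivSqZeroExt.sndHom L.Env L.Env).restrictScalars F ∘ₗ (L.envDualHom T hT).toLinearMap

theorem envDerivation_ι (T : g →ₗ[F] g) (hT : L.IsDerivation T) (x : g) :
    L.envDerivation T hT (L.ι x) = L.ι (T x) := by
  simp [envDerivation, envDualHom]

theorem envDerivation_mul (T : g →ₗ[F] g) (hT : L.IsDerivation T) (u v : L.Env) :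
    L.envDerivation T hT (u * v) = L.envDerivation T hT u * v + u * L.envDerivation T hT v := by
  have hfst : ∀ u, (L.envDualHom T hT u).fst = u := by
    intro u
    have : (TrivSqZeroExt.fstHom F L.Env L.Env).comp (L.envDualHom T hT) = AlgHom.id F _ :=
      L.env_hom_ext fun x => by simp [envDualHom]
    exact DFunLike.congr_fun this u
  simp [envDerivation, hfst, add_comm]

end

/-! ### The induced module `V = U(g)/U(g)g₋` -/

section

variable {F g J : Type*} [Field F] [AddCommGroup g] [Module F g] (L : LieSuperalgebra F g)
  (a : J → ℤ → g)

/-- The left ideal `U(g)g₋`. -/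
def leftIdeal : Submodule L.Env L.Env :=
  Submodule.span L.Env (L.ι '' (annihilation F a : Set g))

/-- `V = U(g)/U(g)g₋`. -/
abbrev Ind : Type _ := L.Env ⧸ L.leftIdeal a

/-- The quotient map `U(g) → V`. -/
def toInd : L.Env →ₗ[F] L.Ind a := (L.leftIdeal a).mkQ.restrictScalars F

/-- The vacuum vector, the image of `1 ∈ U(g)` in `V`. -/
def vacuum : L.Ind a := L.toInd a 1

/-- The subspace of elements of parity `i` of `V`. -/
def indPart (i : ZMod 2) : Submodule F (L.Ind a) := (L.envPart i).map (L.toInd a)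

/-- The representation `π` of `g` in `V` by left multiplication. -/
def rep : g →ₗ[F] Module.End F (L.Ind a) :=
  (Algebra.lsmul F F (L.Ind a)).toLinearMap ∘ₗ L.ι

theorem rep_toInd (x : g) (u : L.Env) :
    L.rep a x (L.toInd a u) = L.toInd a (L.ι x * u) := rfl

/-- The `End V`-valued formal distribution `π(aʲ(z))`. -/
def field (j : J) : ℤ → Module.End F (L.Ind a) := fun n => L.rep a (a j n)

variable {a}

theorem annihilation_invariant {T : g →ₗ[F] g} (hT : L.IsTranslation a T) {x : g}
    (hx : x ∈ annihilation F a) : T x ∈ annihilation F a := by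
  induction hx using Submodule.span_induction with
  | mem x hx =>
    obtain ⟨⟨j, n⟩, rfl⟩ := hx
    have h := congrFun (hT.map_coeff j) n
    simp only [dz] at h
    show T (a j n) ∈ _
    rw [h]
    rcases n with _ | n
    · simp
    · have h' : a j (((n + 1 : ℕ) : ℤ) - 1) ∈ annihilation F a :=
        Submodule.subset_span ⟨(j, n), by simp⟩
      exact neg_mem (zsmul_mem h' _)
  | zero => simp
  | add x y _ _ hx hy => rw [map_add]; exact add_mem hx hy
  | smul c x _ hx => rw [map_smul]; exact Submodule.smul_mem _ _ hx

theorem leftIdeal_invariant {T : g →ₗ[F] g} (hT : L.IsTranslation a T) {u : L.Env}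
    (hu : u ∈ L.leftIdeal a) : L.envDerivation T hT.isDerivation u ∈ L.leftIdeal a := by
  induction hu using Submodule.span_induction with
  | mem u hu =>
    obtain ⟨x, hx, rfl⟩ := hu
    rw [envDerivation_ι]
    exact Submodule.subset_span ⟨_, L.annihilation_invariant hT hx, rfl⟩
  | zero => simp
  | add x y _ _ hx hy => rw [map_add]; exact add_mem hx hy
  | smul c x hx' hx =>
    rw [smul_eq_mul, envDerivation_mul]
    exact add_mem ((L.leftIdeal a).smul_mem _ hx') ((L.leftIdeal a).smul_mem _ hx)

/-- The endomorphism of `V` induced by the derivation `T` of `g`: the derivation of `U(g)` that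
extends `T`, taken modulo the left ideal `U(g)g₋`. -/
def indT {T : g →ₗ[F] g} (hT : L.IsTranslation a T) : Module.End F (L.Ind a) :=
  (Submodule.Quotient.restrictScalarsEquiv F (L.leftIdeal a)).toLinearMap ∘ₗ
    (Submodule.mapQ ((L.leftIdeal a).restrictScalars F) ((L.leftIdeal a).restrictScalars F)
      (L.envDerivation T hT.isDerivation) fun _ hu => L.leftIdeal_invariant hT hu) ∘ₗ
    (Submodule.Quotient.restrictScalarsEquiv F (L.leftIdeal a)).symm.toLinearMap

theorem indT_toInd {T : g →ₗ[F] g} (hT : L.IsTranslation a T) (u : L.Env) :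
    L.indT hT (L.toInd a u) = L.toInd a (L.envDerivation T hT.isDerivation u) := rfl

end

end LieSuperalgebra

/-! ### Vertex superalgebras

`V` is a vector space with subspaces `part i` (`i ∈ ℤ/2ℤ`) of elements of parity `i`; an
`End V`-valued formal distribution is a map `ℤ → Module.End F V`. -/

namespace VertexSuperalgebra

open FormalDistribution

variable {F V : Type*} [Field F] [AddCommGroup V] [Module F V]

/-- `A(z)` is a quantum field: for each `v`, `A₍ₙ₎v = 0` for all sufficiently large `n`. -/
def IsQuantumField (A : ℤ → Module.End F V) : Prop :=
  ∀ v, ∃ N : ℤ, ∀ n, N ≤ n → A n v = 0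

/-- `[T, A(z)] = ∂_z A(z)`. -/
def IsTranslationCovariant (T : Module.End F V) (A : ℤ → Module.End F V) : Prop :=
  (fun n => T * A n - A n * T) = dz A

/-- All coefficients of `A(z)` are operators of parity `p`. -/
def HasParity (part : ZMod 2 → Submodule F V) (p : ZMod 2) (A : ℤ → Module.End F V) : Prop :=
  ∀ n i v, v ∈ part i → A n v ∈ part (p + i)

/-- `(z-w)^N [A(z), B(w)] = 0` for some `N ∈ ℤ₊`, where the supercommutator is
`[A(z), B(w)] = A(z)B(w) - (-1)^{p(A)p(B)} B(w)A(z)` for `A`, `B` homogeneous, extended bilinearly: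
`A 0, A 1` and `B 0, B 1` are the even and odd components of the two distributions. -/
def IsLocalPair (part : ZMod 2 → Submodule F V) (A B : ℤ → Module.End F V) : Prop :=
  ∃ A' B' : ZMod 2 → ℤ → Module.End F V,
    (∀ p, HasParity part p (A' p)) ∧ (∀ p, HasParity part p (B' p)) ∧
    A = A' 0 + A' 1 ∧ B = B' 0 + B' 1 ∧
    IsLocal fun m n => ∑ p, ∑ q, (A' p m * B' q n - superSign p q • (B' q n * A' p m))

/-- The hypotheses of the Extension theorem, for the superspace `V` with the vector `vac`, the
operator `T` and the family of (homogeneous) `End V`-valued distributions `Aʲ(z)`, `j ∈ J`. -/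
structure IsPreVertex {J : Type*} (part : ZMod 2 → Submodule F V) (vac : V)
    (T : Module.End F V) (A : J → ℤ → Module.End F V) : Prop where
  isCompl : IsCompl (part 0) (part 1)
  vac_ne_zero : vac ≠ 0
  vac_even : vac ∈ part 0
  T_even : ∀ i v, v ∈ part i → T v ∈ part i
  homogeneous : ∀ j, ∃ p, HasParity part p (A j)
  isQuantumField : ∀ j, IsQuantumField (A j)
  T_vac : T vac = 0
  translation : ∀ j, IsTranslationCovariant T (A j)
  isLocal : ∀ i j, IsLocalPair part (A i) (A j)
  completeness : Submodule.span F
    (Set.range fun l : List (J × ℤ) => (l.map fun q => A q.1 q.2).prod vac) = ⊤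

/-- `F_max`: all translation covariant quantum fields that form a local pair with every member of
the family `Aʲ(z)`. -/
def Fmax {J : Type*} (part : ZMod 2 → Submodule F V) (T : Module.End F V)
    (A : J → ℤ → Module.End F V) : Set (ℤ → Module.End F V) :=
  {B | IsQuantumField B ∧ IsTranslationCovariant T B ∧ ∀ j, IsLocalPair part B (A j)}

/-- `V` is a vertex superalgebra with vacuum vector `vac`, translation operator `T` and state-field
correspondence `v ↦ v(z) = ∑ₙ v₍ₙ₎ z^{-n-1}`, `v₍ₙ₎ = Y v n`. The field `Y_T` says
`(Tv)(z) = ∂_z v(z)`; together with `translation` it says that `T` is a derivation of all `n`-th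
products, so that `V` is a local unital `z`-superalgebra. -/
structure IsVertexSuperalgebra (part : ZMod 2 → Submodule F V) (vac : V) (T : Module.End F V)
    (Y : V →ₗ[F] ℤ → Module.End F V) : Prop where
  isCompl : IsCompl (part 0) (part 1)
  vac_ne_zero : vac ≠ 0
  T_even : ∀ i v, v ∈ part i → T v ∈ part i
  parity : ∀ i v, v ∈ part i → HasParity part i (Y v)
  isQuantumField : ∀ v, IsQuantumField (Y v)
  Y_vac : ∀ n, Y vac n = if n = -1 then 1 else 0
  Y_apply_vac_nonneg : ∀ v n, 0 ≤ n → Y v n vac = 0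
  Y_apply_vac_neg_one : ∀ v, Y v (-1) vac = v
  Y_apply_vac_neg_two : ∀ v, Y v (-2) vac = T v
  translation : ∀ v, IsTranslationCovariant T (Y v)
  Y_T : ∀ v, Y (T v) = dz (Y v)
  isLocal : ∀ u v, IsLocalPair part (Y u) (Y v)

end VertexSuperalgebra

/-! The theorem splits into a statement about the induced module and the Extension theorem for an
arbitrary superspace with a translation covariant, local, generating family of quantum fields.

For the induced module the main point is truncation. Let `S` be the set of vectors on which every
π(aʲ(z)) has only finitely many nonzero coefficients of positive index. It contains |0⟩, which 𝔤₋
annihilates. If `v ∈ S`, then aʲ₍ₘ₎aⁱ₍ₙ₎v differs, for large m, from [aʲ₍ₘ₎, aⁱ₍ₙ₎]v by a term that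
is zero. The residues of (z-w)ᵏ[aʲ(z), aⁱ(w)] lie in the span of derivatives of the generators by
regularity, so they are truncated on `v`; locality leaves only finitely many k to consider, and
`exists_bound_of_residues` makes the bracket itself vanish on `v` for large m. So `S` is a submodule
containing a generator (`isQuantumField_of_rep`). The vacuum is nonzero by the augmentation of U(𝔤),
without any Poincaré–Birkhoff–Witt theorem, and the grading descends to V because the parity
automorphism of U(𝔤) preserves U(𝔤)𝔤₋.

For the Extension theorem, send a translation covariant quantum field B that is local to the given
family to the vector B₍₋₁₎|0⟩. This map is injective by Goddard's argument (`eq_zero_of_apply_vac`):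
B kills |0⟩, and locality carries this over to every word in the generators. It is surjective
(`exists_localFields`) because the identity field maps to |0⟩ and n-th products of fields realize
the vectors A₍ₙ₎u. That these products stay in the class is Dong's lemma (`exists_nth_product`).
They are obtained, up to a factor k!, by applying ∂ᵏ in z₁ to (z₁-z₂)ᴺA(z₁)B(z₂) and then setting z₁
= z₂; this treats all integers n at once. The state-field correspondence is the inverse map, and its
remaining properties follow from uniqueness of a field with a given vacuum value. Signs are handled
by working with homogeneous fields and splitting general ones into parity components. -/

namespace FormalDistribution

/-! ### Calculus of formal distributions: powers of z - w, truncation, derivatives -/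

section Calculus

variable {U U' : Type*} [AddCommGroup U] [AddCommGroup U']

/-- Multiplication by `z - w` as an additive operator. -/
def mulSubHom (U : Type*) [AddCommGroup U] : Module.End ℤ (ℤ → ℤ → U) where
  toFun := mulSub
  map_add' c d := by ext m n; simp only [mulSub, Pi.add_apply]; abel
  map_smul' k c := by ext m n; simp [mulSub, smul_sub]

theorem mulSub_iterate_eq (N : ℕ) (c : ℤ → ℤ → U) : mulSub^[N] c = (mulSubHom U ^ N) c := by
  rw [Module.End.pow_apply]; rfl

theorem mulSub_iterate_zero (N : ℕ) : mulSub^[N] (0 : ℤ → ℤ → U) = 0 := by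
  rw [mulSub_iterate_eq, map_zero]

theorem mulSub_iterate_add (N : ℕ) (c d : ℤ → ℤ → U) :
    mulSub^[N] (c + d) = mulSub^[N] c + mulSub^[N] d := by
  simp only [mulSub_iterate_eq, map_add]

theorem mulSub_iterate_map (φ : U →+ U') (N : ℕ) (c : ℤ → ℤ → U) :
    mulSub^[N] (fun m n => φ (c m n)) = fun m n => φ (mulSub^[N] c m n) := by
  induction N generalizing c with
  | zero => rfl
  | succ N ih =>
    rw [Function.iterate_succ_apply, Function.iterate_succ_apply, ← ih]
    congr 1
    ext m n
    simp [mulSub]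

theorem mulSub_iterate_swap (N : ℕ) (c : ℤ → ℤ → U) :
    mulSub^[N] (fun m n => c n m) = fun m n => (-1 : ℤ) ^ N • mulSub^[N] c n m := by
  induction N with
  | zero => simp
  | succ N ih =>
    rw [Function.iterate_succ_apply', Function.iterate_succ_apply', ih]
    ext m n
    simp only [mulSub, pow_succ, ← smul_sub, mul_smul]
    congr 1
    simp

theorem mulSub_iterate_mem (S : AddSubgroup U) {c : ℤ → ℤ → U} (h : ∀ m n, c m n ∈ S)
    (N : ℕ) (m n : ℤ) : mulSub^[N] c m n ∈ S := by
  induction N generalizing m n with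
  | zero => exact h m n
  | succ N ih =>
    rw [Function.iterate_succ_apply']
    exact S.sub_mem (ih _ _) (ih _ _)

theorem mulSub_iterate_eq_zero_of_le {c : ℤ → ℤ → U} {N N' : ℕ} (h : N ≤ N')
    (hc : mulSub^[N] c = 0) : mulSub^[N'] c = 0 := by
  obtain ⟨k, rfl⟩ := Nat.exists_eq_add_of_le' h
  rw [Function.iterate_add_apply, hc, mulSub_iterate_zero]

theorem IsLocal.add {c d : ℤ → ℤ → U} (hc : IsLocal c) (hd : IsLocal d) : IsLocal (c + d) := by
  obtain ⟨N, hN⟩ := hc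
  obtain ⟨M, hM⟩ := hd
  refine ⟨max N M, ?_⟩
  rw [mulSub_iterate_add, mulSub_iterate_eq_zero_of_le (le_max_left _ _) hN,
    mulSub_iterate_eq_zero_of_le (le_max_right _ _) hM, add_zero]

theorem IsLocal.map {c : ℤ → ℤ → U} (hc : IsLocal c) (φ : U →+ U') :
    IsLocal fun m n => φ (c m n) := by
  obtain ⟨N, hN⟩ := hc
  refine ⟨N, ?_⟩
  rw [mulSub_iterate_map, hN]
  ext m n
  simp

theorem IsLocal.swap {c : ℤ → ℤ → U} (hc : IsLocal c) : IsLocal fun m n => c n m := by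
  obtain ⟨N, hN⟩ := hc
  refine ⟨N, ?_⟩
  rw [mulSub_iterate_swap, hN]
  ext m n
  simp

theorem isLocal_zero : IsLocal (0 : ℤ → ℤ → U) := ⟨0, rfl⟩

theorem IsLocal.sum {ι : Type*} (s : Finset ι) {c : ι → ℤ → ℤ → U}
    (h : ∀ i ∈ s, IsLocal (c i)) : IsLocal fun m n => ∑ i ∈ s, c i m n := by
  have : (fun m n => ∑ i ∈ s, c i m n) = ∑ i ∈ s, c i := by
    ext m n
    simp [Finset.sum_apply]
  rw [this]
  exact Finset.sum_induction _ IsLocal (fun _ _ => IsLocal.add) isLocal_zero h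

theorem mulSub_iterate_vanish_left {c : ℤ → ℤ → U} {K : ℤ} (h : ∀ m n, K ≤ m → c m n = 0)
    (N : ℕ) (m n : ℤ) (hm : K ≤ m) : mulSub^[N] c m n = 0 := by
  induction N generalizing m n with
  | zero => exact h m n hm
  | succ N ih =>
    rw [Function.iterate_succ_apply', mulSub, ih _ _ (by lia), ih _ _ hm, sub_zero]

theorem mulSub_iterate_vanish_right {c : ℤ → ℤ → U} {K : ℤ} (h : ∀ m n, K ≤ n → c m n = 0)
    (N : ℕ) (m n : ℤ) (hn : K ≤ n) : mulSub^[N] c m n = 0 := by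
  induction N generalizing m n with
  | zero => exact h m n hn
  | succ N ih =>
    rw [Function.iterate_succ_apply', mulSub, ih _ _ (by lia), ih _ _ (by lia), sub_zero]

/-- In the expansion of (z-w)ᴺ every term other than zᴺ raises the second index above `K`, where `c`
vanishes. -/
theorem mulSub_iterate_top {c : ℤ → ℤ → U} {K : ℤ} (h : ∀ m n, K < n → c m n = 0)
    (N : ℕ) (m : ℤ) : mulSub^[N] c m K = c (m + N) K := by
  induction N generalizing m with
  | zero => simp
  | succ N ih =>
    rw [Function.iterate_succ_apply', mulSub, ih,
      mulSub_iterate_vanish_right (K := K + 1) (fun m n hn => h m n (by lia)) _ _ _ le_rfl,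
      sub_zero]
    congr 1
    push_cast
    ring

/-- Multiplication by `z - w` is injective on distributions that are bounded in `w`. -/
theorem eq_zero_of_mulSub_iterate {c : ℤ → ℤ → U} {K : ℤ} (h : ∀ m n, K ≤ n → c m n = 0)
    {N : ℕ} (hN : mulSub^[N] c = 0) : c = 0 := by
  induction N generalizing c with
  | zero => exact hN
  | succ N ih =>
    have h1 : mulSub c = 0 := ih (mulSub_iterate_vanish_right h 1) hN
    -- A distribution killed by z - w is constant along the lines m + n = const, so each coefficient
    -- can be moved to a second index of at least `K`.
    have h2 : ∀ k : ℕ, ∀ m n, K ≤ n + k → c m n = 0 := by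
      intro k
      induction k with
      | zero => intro m n hn; exact h m n (by simpa using hn)
      | succ k ihk =>
        intro m n hn
        have h3 := congrFun (congrFun h1 (m - 1)) n
        rw [mulSub, ihk (m - 1) (n + 1) (by push_cast at hn; lia), sub_zero, sub_add_cancel] at h3
        exact h3
    ext m n
    exact h2 (K - n).toNat m n (by lia)

/-- The partial derivative in the first variable. -/
def dzFst (c : ℤ → ℤ → U) : ℤ → ℤ → U := fun m n => -(m • c (m - 1) n)

/-- Leibniz rule for ∂_z((z-w)c). Hence a derivative costs at most one extra power of z - w. -/
theorem mulSub_dzFst (c : ℤ → ℤ → U) : mulSub (dzFst c) = dzFst (mulSub c) + -c := by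
  ext m n
  simp only [mulSub, dzFst, Pi.add_apply, Pi.neg_apply, sub_add_cancel, add_sub_cancel_right]
  rw [add_smul, smul_sub, one_smul]
  abel

theorem mulSub_iterate_dzFst {c : ℤ → ℤ → U} {N : ℕ} (h : mulSub^[N] c = 0) :
    mulSub^[N + 1] (dzFst c) = 0 := by
  induction N generalizing c with
  | zero =>
    have h' : c = 0 := h
    subst h'
    ext m n
    simp [mulSub, dzFst]
  | succ N ih =>
    rw [Function.iterate_succ_apply, mulSub_dzFst, mulSub_iterate_add, ih h, zero_add]
    rw [mulSub_iterate_eq, map_neg, ← mulSub_iterate_eq, h, neg_zero]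

theorem dz_iterate_neg_one (k : ℕ) (a : ℤ → U) :
    dz^[k] a (-1) = (k.factorial : ℤ) • a (-1 - k) := by
  induction k generalizing a with
  | zero => simp
  | succ k ih =>
    rw [Function.iterate_succ_apply, ih, dz, ← neg_smul, smul_smul, Nat.factorial_succ]
    congr 1
    · push_cast; ring
    · congr 1; push_cast; ring

/-! ### Restriction of a distribution in two variables to the diagonal -/

/-- `g(z,w)` is a Laurent series in both variables. -/
def IsBounded (g : ℤ → ℤ → U) : Prop := ∃ K : ℤ, ∀ m n, K ≤ m ∨ K ≤ n → g m n = 0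

/-- The restriction `g(z,z)` of `g(z,w)` to the diagonal. -/
noncomputable def diag (g : ℤ → ℤ → U) : ℤ → U := fun p => ∑ᶠ i, g i (p - 1 - i)

/-- The exponents satisfy z^{-i-1}z^{-j-1} = z^{-p-1} exactly when j = p - 1 - i. Boundedness leaves
finitely many such i, so the `finsum` in `diag` is a genuine sum and not the default value 0. -/
theorem IsBounded.finite {g : ℤ → ℤ → U} (h : IsBounded g) (p : ℤ) :
    (Function.support fun i => g i (p - 1 - i)).Finite := by
  obtain ⟨K, hK⟩ := h
  refine (Set.finite_Icc (p - 1 - K) K).subset fun i hi => ?_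
  by_contra hc
  refine hi (hK _ _ ?_)
  rw [Set.mem_Icc, not_and_or] at hc
  lia

theorem IsBounded.add {g h : ℤ → ℤ → U} (hg : IsBounded g) (hh : IsBounded h) :
    IsBounded (g + h) := by
  obtain ⟨K, hK⟩ := hg
  obtain ⟨M, hM⟩ := hh
  refine ⟨max K M, fun m n hmn => ?_⟩
  rw [Pi.add_apply, Pi.add_apply, hK _ _ (by lia), hM _ _ (by lia), add_zero]

theorem IsBounded.map {g : ℤ → ℤ → U} (hg : IsBounded g) (φ : U →+ U') :
    IsBounded fun m n => φ (g m n) := by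
  obtain ⟨K, hK⟩ := hg
  exact ⟨K, fun m n hmn => by simp only [hK m n hmn, map_zero]⟩

theorem IsBounded.shift {g : ℤ → ℤ → U} (hg : IsBounded g) (k l : ℤ) :
    IsBounded fun m n => g (m + k) (n + l) := by
  obtain ⟨K, hK⟩ := hg
  exact ⟨max (K - k) (K - l), fun m n hmn => hK _ _ (by lia)⟩

theorem IsBounded.sub {g h : ℤ → ℤ → U} (hg : IsBounded g) (hh : IsBounded h) :
    IsBounded fun m n => g m n - h m n := by
  have := hg.add (hh.map (-AddMonoidHom.id U))
  simpa [sub_eq_add_neg, Pi.add_def] using this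

theorem IsBounded.dzFst {g : ℤ → ℤ → U} (hg : IsBounded g) : IsBounded (dzFst g) := by
  obtain ⟨K, hK⟩ := hg
  exact ⟨K + 1, fun m n hmn => by
    rw [FormalDistribution.dzFst, hK _ _ (by lia), smul_zero, neg_zero]⟩

theorem diag_add {g h : ℤ → ℤ → U} (hg : IsBounded g) (hh : IsBounded h) (p : ℤ) :
    diag (fun m n => g m n + h m n) p = diag g p + diag h p :=
  finsum_add_distrib (hg.finite p) (hh.finite p)

theorem diag_sub {g h : ℤ → ℤ → U} (hg : IsBounded g) (hh : IsBounded h) (p : ℤ) :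
    diag (fun m n => g m n - h m n) p = diag g p - diag h p :=
  finsum_sub_distrib (hg.finite p) (hh.finite p)

theorem diag_map {g : ℤ → ℤ → U} (hg : IsBounded g) (φ : U →+ U') (p : ℤ) :
    diag (fun m n => φ (g m n)) p = φ (diag g p) :=
  (φ.map_finsum (hg.finite p)).symm

theorem diag_shift_right (g : ℤ → ℤ → U) (p : ℤ) :
    diag (fun m n => g m (n + 1)) p = diag g (p + 1) :=
  finsum_congr fun i => by ring_nf

theorem diag_shift_left (g : ℤ → ℤ → U) (p : ℤ) :
    diag (fun m n => g (m + 1) n) p = diag g (p + 1) :=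
  (finsum_congr fun i => by simp only [Equiv.coe_addRight]; ring_nf).trans
    (finsum_comp_equiv (Equiv.addRight (1 : ℤ)) (f := fun i => g i (p + 1 - 1 - i)))

/-- The chain rule for the restriction to the diagonal. -/
theorem dz_diag {g : ℤ → ℤ → U} (hg : IsBounded g) (p : ℤ) :
    diag (fun m n => dzFst g m n + -(n • g m (n - 1))) p = dz (diag g) p := by
  have h1 : IsBounded (fun m n => -(n • g m (n - 1))) := by
    obtain ⟨K, hK⟩ := hg
    exact ⟨K + 1, fun m n hmn => by simp only [hK m (n - 1) (by lia), smul_zero, neg_zero]⟩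
  rw [diag_add hg.dzFst h1]
  -- Both sums are reindexed to the coefficients g(i, j) with i + j = p - 2. There the factors
  -- -(i+1) and -(j+1) add up to the constant -p.
  have h2 : diag (dzFst g) p = diag (fun m n => dzFst g (m + 1) n) (p - 1) := by
    rw [diag_shift_left, sub_add_cancel]
  have h3 : diag (fun m n => -(n • g m (n - 1))) p
      = diag (fun m n => -((n + 1) • g m n)) (p - 1) := by
    have := diag_shift_right (fun m n => -(n • g m (n - 1))) (p - 1)
    rw [sub_add_cancel] at this
    rw [← this]
    simp only [add_sub_cancel_right]
  have h4 : IsBounded (fun m n => -((n + 1) • g m n)) := by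
    obtain ⟨K, hK⟩ := hg
    exact ⟨K, fun m n hmn => by simp only [hK _ _ hmn, smul_zero, neg_zero]⟩
  have h5 : IsBounded (fun m n => dzFst g (m + 1) n) := by
    simpa using hg.dzFst.shift 1 0
  rw [h2, h3, ← diag_add h5 h4, dz]
  have h6 := diag_map hg (-(zmultiplesHom (U →+ U) (AddMonoidHom.id U) p)) (p - 1)
  simp only [zmultiplesHom_apply, AddMonoidHom.neg_apply, AddMonoidHom.smul_apply,
    AddMonoidHom.id_apply] at h6
  rw [← h6]
  refine finsum_congr fun i => ?_
  simp only [dzFst, add_sub_cancel_right]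
  rw [← neg_add, ← add_smul]
  congr 2
  ring

/-! ### Distributions in three variables -/

/-- Multiplication of `X(z₁,z₂,z₃)` by `z₁ - z₃`. -/
def mulSub₁₃ (X : ℤ → ℤ → ℤ → U) : ℤ → ℤ → ℤ → U :=
  fun i j n => X (i + 1) j n - X i j (n + 1)

/-- Multiplication of `X(z₁,z₂,z₃)` by `z₂ - z₃`. -/
def mulSub₂₃ (X : ℤ → ℤ → ℤ → U) : ℤ → ℤ → ℤ → U :=
  fun i j n => X i (j + 1) n - X i j (n + 1)

theorem mulSub₁₃_iterate (N : ℕ) (X : ℤ → ℤ → ℤ → U) :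
    mulSub₁₃^[N] X = fun i j n => mulSub^[N] (fun i n => X i j n) i n := by
  induction N with
  | zero => rfl
  | succ N ih => simp only [Function.iterate_succ_apply', ih]; rfl

theorem mulSub₂₃_iterate (N : ℕ) (X : ℤ → ℤ → ℤ → U) :
    mulSub₂₃^[N] X = fun i => mulSub^[N] (X i) := by
  induction N with
  | zero => rfl
  | succ N ih => simp only [Function.iterate_succ_apply', ih]; rfl

theorem commute_mulSub₁₃_mulSub₂₃ : Function.Commute (mulSub₁₃ (U := U)) mulSub₂₃ := by
  intro X
  ext i j n
  simp only [mulSub₁₃, mulSub₂₃]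
  abel

theorem commute_mulSub₁₃_mulSub :
    Function.Commute (mulSub₁₃ (U := U)) (mulSub (U := ℤ → U)) := by
  intro X
  ext i j n
  simp only [mulSub₁₃, mulSub, Pi.sub_apply]
  abel

theorem commute_mulSub₂₃_mulSub :
    Function.Commute (mulSub₂₃ (U := U)) (mulSub (U := ℤ → U)) := by
  intro X
  ext i j n
  simp only [mulSub₂₃, mulSub, Pi.sub_apply]
  abel

theorem commute_mulSub₂₃_dzFst :
    Function.Commute (mulSub₂₃ (U := U)) (dzFst (U := ℤ → U)) := by
  intro X
  ext i j n
  simp only [mulSub₂₃, dzFst, Pi.neg_apply, Pi.smul_apply, smul_sub]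
  abel

/-- On the diagonal z₁ = z₂ = z both z₁ - z₃ and z₂ - z₃ become z - w. Boundedness is what allows
the sum of a difference to be split. -/
theorem mulSub_diag {X : ℤ → ℤ → ℤ → U} (hX : ∀ n, IsBounded fun i j => X i j n) :
    (mulSub fun p n => diag (fun i j => X i j n) p) =
      (fun p n => diag (fun i j => mulSub₁₃ X i j n) p) ∧
    (mulSub fun p n => diag (fun i j => X i j n) p) =
      (fun p n => diag (fun i j => mulSub₂₃ X i j n) p) := by
  constructor
  · ext p n
    simp only [mulSub, mulSub₁₃]
    rw [diag_sub (by simpa using (hX n).shift 1 0) (hX (n + 1)),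
      diag_shift_left (fun i j => X i j n)]
  · ext p n
    simp only [mulSub, mulSub₂₃]
    rw [diag_sub (by simpa using (hX n).shift 0 1) (hX (n + 1)),
      diag_shift_right (fun i j => X i j n)]

/-- If `(z₁ - z₃)^r (z₂ - z₃)^s X = 0` then `(z - w)^(r+s) X(z,z,w) = 0`. -/
theorem mulSub_iterate_diag_eq_zero {X : ℤ → ℤ → ℤ → U} (hX : ∀ n, IsBounded fun i j => X i j n) (r s : ℕ)
    (h : mulSub₁₃^[r] (mulSub₂₃^[s] X) = 0) :
    (mulSub^[r + s] fun p n => diag (fun i j => X i j n) p) = 0 := by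
  have b13 : ∀ X : ℤ → ℤ → ℤ → U, (∀ n, IsBounded fun i j => X i j n) →
      ∀ n, IsBounded fun i j => mulSub₁₃ X i j n := fun X hX n =>
    IsBounded.sub (by simpa using (hX n).shift 1 0) (hX (n + 1))
  have b23 : ∀ X : ℤ → ℤ → ℤ → U, (∀ n, IsBounded fun i j => X i j n) →
      ∀ n, IsBounded fun i j => mulSub₂₃ X i j n := fun X hX n =>
    IsBounded.sub (by simpa using (hX n).shift 0 1) (hX (n + 1))
  have key13 : ∀ (r : ℕ) (X : ℤ → ℤ → ℤ → U), (∀ n, IsBounded fun i j => X i j n) →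
      (mulSub^[r] fun p n => diag (fun i j => X i j n) p) =
        fun p n => diag (fun i j => mulSub₁₃^[r] X i j n) p := by
    intro r
    induction r with
    | zero => intro X _; rfl
    | succ r ih =>
      intro X hX
      rw [Function.iterate_succ_apply, (mulSub_diag hX).1, ih _ (b13 X hX)]
      rfl
  have key23 : ∀ (s : ℕ) (X : ℤ → ℤ → ℤ → U), (∀ n, IsBounded fun i j => X i j n) →
      (∀ n, IsBounded fun i j => mulSub₂₃^[s] X i j n) ∧
      (mulSub^[s] fun p n => diag (fun i j => X i j n) p) =
        fun p n => diag (fun i j => mulSub₂₃^[s] X i j n) p := by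
    intro s
    induction s with
    | zero => intro X hX; exact ⟨hX, rfl⟩
    | succ s ih =>
      intro X hX
      refine ⟨(ih _ (b23 X hX)).1, ?_⟩
      rw [Function.iterate_succ_apply, (mulSub_diag hX).2, (ih _ (b23 X hX)).2]
      rfl
  rw [Function.iterate_add_apply, (key23 s X hX).2, key13 r _ (key23 s X hX).1, h]
  ext p n
  simp [diag]

end Calculus

end FormalDistribution

/-! ### Parities and signs -/

theorem ZMod.eq_zero_or_one_of_two (p : ZMod 2) : p = 0 ∨ p = 1 := by
  revert p; decide

theorem ZMod.sum_two {M : Type*} [AddCommMonoid M] (f : ZMod 2 → M) : ∑ p, f p = f 0 + f 1 :=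
  Fin.sum_univ_two f

theorem superSign_mul_self (p q : ZMod 2) : superSign p q * superSign p q = 1 := by
  revert p q; decide

theorem superSign_comm (p q : ZMod 2) : superSign p q = superSign q p := by
  revert p q; decide

theorem superSign_add_left (p q r : ZMod 2) :
    superSign (p + q) r = superSign p r * superSign q r := by
  revert p q r; decide

namespace VertexSuperalgebra

open FormalDistribution

/-! ### Locality with a fixed sign, Dong's lemma and uniqueness -/

section SignedLocality

variable {F V : Type*} [Field F] [AddCommGroup V] [Module F V]

/-- `(z-w)^N (A(z)B(w) - ε B(w)A(z)) = 0` for some `N`. -/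
def IsSignedLocal (ε : ℤ) (A B : ℤ → Module.End F V) : Prop :=
  IsLocal fun m n => A m * B n - ε • (B n * A m)

variable {ε ε₁ ε₂ : ℤ} {A B C D : ℤ → Module.End F V}

theorem mulSub_iterate_apply (N : ℕ) (c : ℤ → ℤ → Module.End F V) (v : V) :
    (mulSub^[N] fun m n => c m n v) = fun m n => mulSub^[N] c m n v :=
  mulSub_iterate_map (LinearMap.applyₗ (R := F) v).toAddMonoidHom N c

theorem IsSignedLocal.symm (hε : ε * ε = 1) (h : IsSignedLocal ε A B) : IsSignedLocal ε B A := by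
  have h1 := (IsLocal.swap h).map (zmultiplesHom (Module.End F V →+ Module.End F V)
    (AddMonoidHom.id _) (-ε))
  unfold IsSignedLocal
  convert h1 using 3 with m n
  simp only [zmultiplesHom_apply, AddMonoidHom.smul_apply, AddMonoidHom.id_apply, smul_sub,
    smul_smul, neg_mul, hε]
  module

theorem isSignedLocal_zero_left : IsSignedLocal ε 0 B := by
  refine ⟨0, ?_⟩
  ext m n
  simp

theorem isSignedLocal_zero_right : IsSignedLocal ε B 0 := by
  refine ⟨0, ?_⟩
  ext m n
  simp

theorem IsSignedLocal.add_left (hA : IsSignedLocal ε A C) (hB : IsSignedLocal ε B C) :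
    IsSignedLocal ε (A + B) C := by
  unfold IsSignedLocal
  convert IsLocal.add hA hB using 1
  ext m n : 2
  simp only [Pi.add_apply, add_mul, mul_add, smul_add]
  abel

theorem IsSignedLocal.smul_left (c : F) (hA : IsSignedLocal ε A C) :
    IsSignedLocal ε (c • A) C := by
  unfold IsSignedLocal
  convert IsLocal.map hA (LinearMap.lsmul F (Module.End F V) c).toAddMonoidHom using 3 with m n
  simp only [Pi.smul_apply, smul_mul_assoc, mul_smul_comm, LinearMap.toAddMonoidHom_coe,
    LinearMap.lsmul_apply, smul_sub, smul_comm c ε]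

theorem IsSignedLocal.dz_left (hA : IsSignedLocal ε A C) : IsSignedLocal ε (dz A) C := by
  obtain ⟨N, hN⟩ := hA
  refine ⟨N + 1, ?_⟩
  rw [← mulSub_iterate_dzFst hN]
  congr 1
  ext m n : 2
  simp only [dz, dzFst, neg_mul, mul_neg, smul_mul_assoc, mul_smul_comm, smul_sub, smul_neg,
    smul_comm ε m]
  abel

/-- Joint locality of `G(z₁,z₂)` and `D(w)`. -/
def IsBilocal (ε : ℤ) (G : ℤ → ℤ → Module.End F V) (D : ℤ → Module.End F V) : Prop :=
  ∃ r s : ℕ, mulSub₁₃^[r] (mulSub₂₃^[s] fun i j n => G i j * D n - ε • (D n * G i j)) = 0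

/-- The identity ABD - ε₁ε₂DAB = A(BD - ε₂DB) + ε₂(AD - ε₁DA)B splits the commutator into a part
killed by (z₂-z₃)ˢ and a part killed by (z₁-z₃)ʳ. These two multiplications commute, so their
product kills both. -/
theorem IsSignedLocal.mul (hA : IsSignedLocal ε₁ A D) (hB : IsSignedLocal ε₂ B D) :
    IsBilocal (ε₁ * ε₂) (fun i j => A i * B j) D := by
  obtain ⟨r, hr⟩ := hA
  obtain ⟨s, hs⟩ := hB
  refine ⟨r, s, ?_⟩
  have e : (fun i j n => A i * B j * D n - (ε₁ * ε₂) • (D n * (A i * B j))) =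
      fun i j n => A i * (B j * D n - ε₂ • (D n * B j)) +
        ε₂ • ((A i * D n - ε₁ • (D n * A i)) * B j) := by
    ext i j n : 3
    rw [mul_comm ε₁]
    simp only [mul_sub, sub_mul, smul_sub, mul_smul_comm, smul_mul_assoc, mul_smul, mul_assoc]
    abel
  have e2 : (mulSub₂₃^[s] fun i j n => A i * (B j * D n - ε₂ • (D n * B j)) +
      ε₂ • ((A i * D n - ε₁ • (D n * A i)) * B j)) =
      mulSub₂₃^[s] fun i j n => ε₂ • ((A i * D n - ε₁ • (D n * A i)) * B j) := by
    simp only [mulSub₂₃_iterate]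
    ext i : 1
    have h1 := mulSub_iterate_map (AddMonoidHom.mulLeft (A i)) s
      (fun j n => B j * D n - ε₂ • (D n * B j))
    rw [hs] at h1
    have h2 := mulSub_iterate_add s (fun j n => A i * (B j * D n - ε₂ • (D n * B j)))
      (fun j n => ε₂ • ((A i * D n - ε₁ • (D n * A i)) * B j))
    refine h2.trans ?_
    rw [show (mulSub^[s] fun j n => A i * (B j * D n - ε₂ • (D n * B j))) = 0 from
      h1.trans (by ext; simp), zero_add]
  rw [e, e2, (commute_mulSub₁₃_mulSub₂₃.iterate_iterate r s).eq]
  have e3 : (mulSub₁₃^[r] fun i j n => ε₂ • ((A i * D n - ε₁ • (D n * A i)) * B j)) = 0 := by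
    rw [mulSub₁₃_iterate]
    ext i j n : 3
    have h1 := mulSub_iterate_map (ε₂ • AddMonoidHom.mulRight (B j)) r
      (fun i n => A i * D n - ε₁ • (D n * A i))
    rw [hr] at h1
    exact (congrFun (congrFun h1 i) n).trans (by simp)
  rw [e3, mulSub₂₃_iterate]
  ext i : 1
  exact mulSub_iterate_zero s

/-- The commutator with D is additive in G, so (z₁-z₂)ᴺ can be pulled out of it, and it commutes
with the other two factors. -/
theorem IsBilocal.mulSub_iterate {G : ℤ → ℤ → Module.End F V} (h : IsBilocal ε G D) (N : ℕ) :
    IsBilocal ε (mulSub^[N] G) D := by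
  obtain ⟨r, s, h⟩ := h
  refine ⟨r, s, ?_⟩
  let φ : Module.End F V →+ (ℤ → Module.End F V) :=
    { toFun := fun f n => f * D n - ε • (D n * f)
      map_zero' := by ext; simp
      map_add' := fun f g => by
        ext n : 1
        simp only [Pi.add_apply, add_mul, mul_add, smul_add]
        abel }
  have h1 := mulSub_iterate_map φ N G
  have h2 : (fun i j n => mulSub^[N] G i j * D n - ε • (D n * mulSub^[N] G i j)) =
      mulSub^[N] fun i j => φ (G i j) := h1.symm
  rw [h2, (commute_mulSub₂₃_mulSub.iterate_iterate s N).eq,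
    (commute_mulSub₁₃_mulSub.iterate_iterate r N).eq]
  exact (congrArg _ h).trans (mulSub_iterate_zero N)

theorem IsBilocal.dzFst {G : ℤ → ℤ → Module.End F V} (h : IsBilocal ε G D) :
    IsBilocal ε (dzFst G) D := by
  obtain ⟨r, s, h⟩ := h
  refine ⟨r + 1, s, ?_⟩
  have h2 : (fun i j n => FormalDistribution.dzFst G i j * D n -
      ε • (D n * FormalDistribution.dzFst G i j)) =
      FormalDistribution.dzFst fun i j n => G i j * D n - ε • (D n * G i j) := by
    ext i j n : 3
    simp only [FormalDistribution.dzFst, neg_mul, mul_neg, smul_mul_assoc, mul_smul_comm,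
      smul_sub, smul_neg, Pi.neg_apply, Pi.smul_apply, smul_comm ε i]
    abel
  rw [h2, (commute_mulSub₂₃_dzFst.iterate_left s).eq, mulSub₁₃_iterate]
  rw [mulSub₁₃_iterate] at h
  ext i j n : 3
  have h3 := mulSub_iterate_dzFst (c := fun i n =>
    (mulSub₂₃^[s] fun i j n => G i j * D n - ε • (D n * G i j)) i j n) (N := r) (by
      ext i n : 2
      exact congrFun (congrFun (congrFun h i) j) n)
  exact congrFun (congrFun h3 i) n

/-- `G(z₁,z₂)` is a quantum field in two variables. -/
def IsField₂ (G : ℤ → ℤ → Module.End F V) : Prop := ∀ v, IsBounded fun i j => G i j v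

/-- The restriction `G(z,z)` of a quantum field in two variables to the diagonal. -/
noncomputable def diagEnd (G : ℤ → ℤ → Module.End F V) (hG : IsField₂ G) :
    ℤ → Module.End F V := fun p =>
  { toFun := fun v => diag (fun i j => G i j v) p
    map_add' := fun u v => by
      simp only [map_add]
      exact diag_add (hG u) (hG v) p
    map_smul' := fun c v => by
      simp only [map_smul]
      exact diag_map (hG v) (LinearMap.lsmul F V c).toAddMonoidHom p }

variable {G : ℤ → ℤ → Module.End F V} {T : Module.End F V}

theorem diagEnd_apply (hG : IsField₂ G) (p : ℤ) (v : V) :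
    diagEnd G hG p v = diag (fun i j => G i j v) p := rfl

theorem IsBilocal.diagEnd (h : IsBilocal ε G D) (hG : IsField₂ G) :
    IsSignedLocal ε (diagEnd G hG) D := by
  obtain ⟨r, s, h⟩ := h
  refine ⟨r + s, ?_⟩
  ext m n v
  have hb : ∀ n, IsBounded fun i j => (G i j * D n - ε • (D n * G i j)) v := fun n =>
    (hG (D n v)).sub ((hG v).map (ε • D n).toAddMonoidHom)
  have hz := mulSub_iterate_diag_eq_zero hb r s (by
    rw [mulSub₁₃_iterate] at h ⊢
    rw [mulSub₂₃_iterate] at h ⊢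
    ext i j n
    simp only [mulSub_iterate_apply]
    exact LinearMap.congr_fun (congrFun (congrFun (congrFun h i) j) n) v)
  rw [← congrFun (congrFun (mulSub_iterate_apply (r + s) _ v) m) n]
  refine (congrFun (congrFun (congrArg _ ?_) m) n).trans (congrFun (congrFun hz m) n)
  ext p n
  have h1 := diag_sub (hG (D n v)) ((hG v).map (ε • D n).toAddMonoidHom) p
  rw [diag_map (hG v)] at h1
  exact h1.symm

theorem isQuantumField_diagEnd (hG : IsField₂ G) : IsQuantumField (diagEnd G hG) := by
  intro v
  obtain ⟨K, hK⟩ := hG v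
  -- The indices on the diagonal satisfy i + j = n - 1 ≥ 2K, so one of them is at least `K`.
  refine ⟨2 * K + 1, fun n hn => ?_⟩
  rw [diagEnd_apply, diag]
  exact finsum_eq_zero_of_forall_eq_zero fun i => hK _ _ (by lia)

/-- `[T, G(z₁,z₂)] = (∂_{z₁} + ∂_{z₂}) G(z₁,z₂)`. -/
def IsTranslationCovariant₂ (T : Module.End F V) (G : ℤ → ℤ → Module.End F V) : Prop :=
  ∀ i j, T * G i j - G i j * T = dzFst G i j + -(j • G i (j - 1))

theorem IsTranslationCovariant.mul (hA : IsTranslationCovariant T A)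
    (hB : IsTranslationCovariant T B) :
    IsTranslationCovariant₂ T fun i j => A i * B j := by
  intro i j
  have h1 : T * A i - A i * T = -(i • A (i - 1)) := congrFun hA i
  have h2 : T * B j - B j * T = -(j • B (j - 1)) := congrFun hB j
  have : T * (A i * B j) - A i * B j * T = (T * A i - A i * T) * B j + A i * (T * B j - B j * T) :=
    by noncomm_ring
  rw [this, h1, h2]
  simp only [dzFst, neg_mul, mul_neg, smul_mul_assoc, mul_smul_comm]

/-- The operator ∂_{z₁} + ∂_{z₂} annihilates z₁ - z₂, hence commutes with multiplication by it. -/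
theorem IsTranslationCovariant₂.mulSub_iterate (h : IsTranslationCovariant₂ T G) (N : ℕ) :
    IsTranslationCovariant₂ T (mulSub^[N] G) := by
  induction N with
  | zero => exact h
  | succ N ih =>
    rw [Function.iterate_succ_apply']
    generalize mulSub^[N] G = G at ih
    intro i j
    have h1 := ih (i + 1) j
    have h2 := ih i (j + 1)
    simp only [mulSub, dzFst, add_sub_cancel_right, sub_add_cancel] at h1 h2 ⊢
    rw [mul_sub, sub_mul, sub_sub_sub_comm, h1, h2]
    module

theorem IsTranslationCovariant₂.dzFst (h : IsTranslationCovariant₂ T G) :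
    IsTranslationCovariant₂ T (dzFst G) := by
  intro i j
  have h1 := h (i - 1) j
  simp only [FormalDistribution.dzFst, mul_neg, neg_mul, mul_smul_comm, smul_mul_assoc] at h1 ⊢
  rw [← neg_sub', ← smul_sub, h1]
  module

theorem IsTranslationCovariant₂.diagEnd (h : IsTranslationCovariant₂ T G) (hG : IsField₂ G) :
    IsTranslationCovariant T (diagEnd G hG) := by
  ext p v
  have h1 : ∀ i j, T (G i j v) - G i j (T v) =
      FormalDistribution.dzFst (fun i j => G i j v) i j + -(j • G i (j - 1) v) := fun i j =>
    LinearMap.congr_fun (h i j) v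
  simp only [LinearMap.sub_apply, Module.End.mul_apply, diagEnd_apply]
  have h2 := diag_map (hG v) T.toAddMonoidHom p
  have h3 := diag_sub ((hG v).map T.toAddMonoidHom) (hG (T v)) p
  rw [h2] at h3
  refine h3.symm.trans ?_
  simp only [LinearMap.toAddMonoidHom_coe, h1]
  rw [dz_diag (hG v)]
  rfl

theorem IsField₂.dzFst (h : IsField₂ G) : IsField₂ (dzFst G) := fun v => (h v).dzFst

/-- For p = -1 the indices satisfy i + j = -2, and i = j = -1 is the only solution with both
negative. -/
theorem diagEnd_neg_one (hG : IsField₂ G) {v : V} (h : ∀ i j, 0 ≤ i ∨ 0 ≤ j → G i j v = 0) :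
    diagEnd G hG (-1) v = G (-1) (-1) v := by
  rw [diagEnd_apply, diag, finsum_eq_single _ (-1)]
  · rfl
  · intro i hi
    exact h _ _ (by lia)

theorem dzFst_iterate_apply (k : ℕ) (G : ℤ → ℤ → Module.End F V) (j : ℤ) :
    dzFst^[k] G (-1) j = (k.factorial : ℤ) • G (-1 - k) j := by
  have h : dzFst^[k] G = fun i j => dz^[k] (fun i => G i j) i := by
    induction k with
    | zero => rfl
    | succ k ih => simp only [Function.iterate_succ_apply', ih]; rfl
  rw [h]
  exact dz_iterate_neg_one k _

theorem IsTranslationCovariant.apply (hB : IsTranslationCovariant T B) (n : ℤ) (v : V) :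
    T (B n v) - B n (T v) = -(n • B (n - 1) v) :=
  LinearMap.congr_fun (congrFun hB n) v

theorem IsTranslationCovariant.dz (hB : IsTranslationCovariant T B) :
    IsTranslationCovariant T (dz B) := by
  ext n v
  have h := hB.apply (n - 1) v
  simp only [FormalDistribution.dz, LinearMap.sub_apply, Module.End.mul_apply,
    LinearMap.neg_apply, LinearMap.smul_apply, map_neg, map_zsmul]
  rw [← h]
  module

theorem IsQuantumField.dz (hB : IsQuantumField B) : IsQuantumField (dz B) := by
  intro v
  obtain ⟨N, hN⟩ := hB v
  exact ⟨N + 1, fun n hn => by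
    rw [FormalDistribution.dz, LinearMap.neg_apply, LinearMap.smul_apply, hN _ (by lia),
      smul_zero, neg_zero]⟩

/-- After multiplication by (z-w)ᴺ the products AB and εBA agree. The first is truncated in w
because B acts first on the vector, the second in z because A does. -/
theorem isField₂_mulSub_iterate_mul {N : ℕ} (hA : IsQuantumField A) (hB : IsQuantumField B)
    (hN : mulSub^[N] (fun m n => A m * B n - ε • (B n * A m)) = 0) :
    IsField₂ (mulSub^[N] fun m n => A m * B n) ∧
    ∀ v, (∀ n, 0 ≤ n → A n v = 0) → (∀ n, 0 ≤ n → B n v = 0) → ∀ i j, 0 ≤ i ∨ 0 ≤ j →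
      mulSub^[N] (fun m n => A m * B n) i j v = 0 := by
  have e1 : ∀ v, (fun i j => mulSub^[N] (fun m n => A m * B n) i j v) =
      mulSub^[N] fun m n => A m (B n v) := fun v =>
    (mulSub_iterate_apply N _ v).symm
  have e2 : ∀ v, (fun i j => mulSub^[N] (fun m n => A m * B n) i j v) =
      mulSub^[N] fun m n => ε • B n (A m v) := by
    intro v
    have h1 : (mulSub^[N] fun m n => A m * B n) = mulSub^[N] fun m n => ε • (B n * A m) := by
      have h2 := mulSub_iterate_add N (fun m n => A m * B n - ε • (B n * A m))
        (fun m n => ε • (B n * A m))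
      rw [hN, zero_add] at h2
      rw [← h2]
      congr 1
      ext m n : 2
      simp
    rw [h1]
    exact (mulSub_iterate_apply N _ v).symm
  have key : ∀ v K L, (∀ n, K ≤ n → A n v = 0) → (∀ n, L ≤ n → B n v = 0) → ∀ i j,
      K ≤ i ∨ L ≤ j → mulSub^[N] (fun m n => A m * B n) i j v = 0 := by
    intro v K L hK hL i j hij
    rcases hij with hi | hj
    · rw [show mulSub^[N] (fun m n => A m * B n) i j v = _ from
        congrFun (congrFun (e2 v) i) j]
      exact mulSub_iterate_vanish_left (fun m n hm => by simp [hK m hm]) N i j hi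
    · rw [show mulSub^[N] (fun m n => A m * B n) i j v = _ from
        congrFun (congrFun (e1 v) i) j]
      exact mulSub_iterate_vanish_right (fun m n hn => by simp [hL n hn]) N i j hj
  refine ⟨fun v => ?_, fun v => key v 0 0⟩
  obtain ⟨K, hK⟩ := hA v
  obtain ⟨L, hL⟩ := hB v
  exact ⟨max K L, fun m n hmn => key v K L hK hL m n (by lia)⟩

theorem HasParity.diagEnd {part : ZMod 2 → Submodule F V} {p : ZMod 2}
    (h : ∀ i, HasParity part p (G i)) (hG : IsField₂ G) : HasParity part p (diagEnd G hG) := by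
  intro n i v hv
  rw [diagEnd_apply, diag]
  exact finsum_induction (· ∈ part (p + i)) (zero_mem _) (fun _ _ => add_mem)
    fun k => h _ _ _ _ hv

theorem HasParity.mulSub_iterate {part : ZMod 2 → Submodule F V} {p : ZMod 2}
    (h : ∀ i, HasParity part p (G i)) (N : ℕ) (i : ℤ) : HasParity part p (mulSub^[N] G i) := by
  induction N generalizing i with
  | zero => exact h i
  | succ N ih =>
    rw [Function.iterate_succ_apply']
    exact fun n k v hv => sub_mem (ih (i + 1) n k v hv) (ih i (n + 1) k v hv)

/-- A version of Dong's lemma: up to a non-zero factor, `C(z)` is the `n`-th product of `A(z)`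
and `B(z)`. -/
theorem exists_nth_product {vac : V} (hA : IsQuantumField A) (hB : IsQuantumField B)
    (hTA : IsTranslationCovariant T A) (hTB : IsTranslationCovariant T B)
    (hvA : ∀ n, 0 ≤ n → A n vac = 0) (hvB : ∀ n, 0 ≤ n → B n vac = 0)
    (hAB : IsSignedLocal ε A B) (n : ℤ) :
    ∃ (k : ℕ) (C : ℤ → Module.End F V), IsQuantumField C ∧ IsTranslationCovariant T C ∧
      C (-1) vac = (k.factorial : ℤ) • A n (B (-1) vac) ∧
      (∀ (part : ZMod 2 → Submodule F V) (p q : ZMod 2), HasParity part p A →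
        HasParity part q B → HasParity part (p + q) C) ∧
      ∀ (D : ℤ → Module.End F V) (ε₁ ε₂ : ℤ), IsSignedLocal ε₁ A D → IsSignedLocal ε₂ B D →
        IsSignedLocal (ε₁ * ε₂) C D := by
  obtain ⟨M, hM⟩ := hAB
  -- The exponent N must be at least M for locality and at least n + 1 for k = N - n - 1 to be a
  -- natural number. This k makes -1 - k + N equal to n in the final computation.
  obtain ⟨k, hk⟩ : ∃ k : ℕ, n + k + 1 = ((max M (n + 1).toNat : ℕ) : ℤ) :=
    ⟨(((max M (n + 1).toNat : ℕ) : ℤ) - n - 1).toNat, by lia⟩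
  set N := max M (n + 1).toNat with hN
  have hN0 := mulSub_iterate_eq_zero_of_le (le_max_left M (n + 1).toNat) hM
  obtain ⟨hG, hGv⟩ := isField₂_mulSub_iterate_mul (N := N) hA hB hN0
  set G := mulSub^[N] fun m n => A m * B n with hGdef
  have hGk : ∀ k : ℕ, IsField₂ (dzFst^[k] G) ∧ IsTranslationCovariant₂ T (dzFst^[k] G) ∧
      (∀ i j, 0 ≤ i ∨ 0 ≤ j → dzFst^[k] G i j vac = 0) ∧
      (∀ (part : ZMod 2 → Submodule F V) (p q : ZMod 2), HasParity part p A →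
        HasParity part q B → ∀ i, HasParity part (p + q) (dzFst^[k] G i)) ∧
      ∀ (D : ℤ → Module.End F V) (ε₁ ε₂ : ℤ), IsSignedLocal ε₁ A D → IsSignedLocal ε₂ B D →
        IsBilocal (ε₁ * ε₂) (dzFst^[k] G) D := by
    intro k
    induction k with
    | zero =>
      refine ⟨hG, (hTA.mul hTB).mulSub_iterate N, hGv vac hvA hvB, fun part p q hp hq =>
        HasParity.mulSub_iterate (fun i m r v hv => ?_) N,
        fun D ε₁ ε₂ h1 h2 => (h1.mul h2).mulSub_iterate N⟩
      rw [add_assoc]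
      exact hp _ _ _ (hq _ _ _ hv)
    | succ k ih =>
      obtain ⟨h1, h2, h3, h4, h5⟩ := ih
      rw [Function.iterate_succ_apply']
      refine ⟨h1.dzFst, h2.dzFst, fun i j hij => ?_, fun part p q hp hq i m r v hv => ?_,
        fun D ε₁ ε₂ hD1 hD2 => (h5 D ε₁ ε₂ hD1 hD2).dzFst⟩
      · rw [dzFst, LinearMap.neg_apply, LinearMap.smul_apply]
        -- At i = 0 the derivative refers to the index -1, where nothing is known, but its factor i
        -- is zero.
        by_cases hi : i = 0
        · rw [hi, zero_smul, neg_zero]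
        · rw [h3 _ _ (by lia), smul_zero, neg_zero]
      · rw [dzFst, LinearMap.neg_apply, LinearMap.smul_apply]
        exact neg_mem (zsmul_mem (h4 part p q hp hq _ _ _ _ hv) _)
  obtain ⟨h1, h2, h3, h4, h5⟩ := hGk k
  refine ⟨k, diagEnd _ h1, isQuantumField_diagEnd h1, h2.diagEnd h1, ?_,
    fun part p q hp hq => HasParity.diagEnd (h4 part p q hp hq) h1,
    fun D ε₁ ε₂ hD1 hD2 => (h5 D ε₁ ε₂ hD1 hD2).diagEnd h1⟩
  rw [diagEnd_neg_one h1 h3, dzFst_iterate_apply, LinearMap.smul_apply]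
  congr 1
  have e1 := mulSub_iterate_apply N (fun m n => A m * B n) vac
  have e2 := mulSub_iterate_top (c := fun m n => A m (B n vac)) (K := -1)
    (fun m n hn => by rw [hvB n (by lia), map_zero]) N (-1 - k)
  refine (congrFun (congrFun e1.symm _) _).trans (e2.trans ?_)
  rw [show (-1 - k + N : ℤ) = n by lia]

/-! ### Uniqueness -/

variable {vac : V}

theorem apply_vac_neg_two (hT : T vac = 0) (hB : IsTranslationCovariant T B) :
    B (-2) vac = T (B (-1) vac) := by
  have h := hB.apply (-1) vac
  rw [hT, map_zero, sub_zero] at h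
  simpa using h.symm

variable [CharZero F]

/-- Since T kills the vacuum, B₍ₙ₊₁₎|0⟩ = 0 gives (n+1)B₍ₙ₎|0⟩ = 0. In characteristic zero this
descends from the truncation bound to n = 0 and stops there, because the next factor is 0. -/
theorem apply_vac_nonneg (hT : T vac = 0) (hB : IsTranslationCovariant T B)
    (hQ : IsQuantumField B) (n : ℤ) (hn : 0 ≤ n) : B n vac = 0 := by
  obtain ⟨K, hK⟩ := hQ vac
  have h : ∀ k : ℕ, ∀ n : ℤ, 0 ≤ n → K ≤ n + k → B n vac = 0 := by
    intro k
    induction k with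
    | zero => intro n _ h; exact hK n (by simpa using h)
    | succ k ih =>
      intro n hn h
      have h1 := hB.apply (n + 1) vac
      rw [ih (n + 1) (by lia) (by push_cast at h; lia), hT, map_zero, map_zero, sub_zero,
        add_sub_cancel_right, eq_comm, neg_eq_zero, ← Int.cast_smul_eq_zsmul F,
        smul_eq_zero] at h1
      refine h1.resolve_left ?_
      exact_mod_cast (by lia : n + 1 ≠ 0)
  exact h (K - n).toNat n hn (by lia)

/-- Goddard's uniqueness theorem. -/
theorem eq_zero_of_apply_vac {J : Type*} {A : J → ℤ → Module.End F V} (hT : T vac = 0)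
    (hA : ∀ j, IsQuantumField (A j))
    (hc : Submodule.span F
      (Set.range fun l : List (J × ℤ) => (l.map fun q => A q.1 q.2).prod vac) = ⊤)
    (hB : IsTranslationCovariant T B) (hQ : IsQuantumField B)
    (hl : ∀ j, ∃ ε, IsSignedLocal ε B (A j)) (h0 : B (-1) vac = 0) : B = 0 := by
  have hvac : ∀ n, B n vac = 0 := by
    intro n
    rcases le_or_gt 0 n with hn | hn
    · exact apply_vac_nonneg hT hB hQ n hn
    · have h : ∀ k : ℕ, B (-1 - k) vac = 0 := by
        intro k
        induction k with
        | zero => simpa using h0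
        | succ k ih =>
          have h1 := hB.apply (-1 - k) vac
          rw [ih, hT, map_zero, map_zero, sub_zero, eq_comm, neg_eq_zero,
            ← Int.cast_smul_eq_zsmul F, smul_eq_zero] at h1
          have h2 := h1.resolve_left (by exact_mod_cast (by lia : (-1 - k : ℤ) ≠ 0))
          rw [← h2]
          congr 2
          push_cast
          ring
      rw [show n = -1 - ((-1 - n).toNat : ℤ) by lia]
      exact h _
  -- Induction on the length of the word. If B(z)u = 0, locality leaves (z-w)ᴺB(z)A(w)u = 0, and
  -- A(w)u is truncated in w, so the power of z - w can be cancelled.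
  have hprod : ∀ l : List (J × ℤ), ∀ n, B n ((l.map fun q => A q.1 q.2).prod vac) = 0 := by
    intro l
    induction l with
    | nil => simpa using hvac
    | cons q l ih =>
      intro n
      set u := (l.map fun q => A q.1 q.2).prod vac
      obtain ⟨ε, N, hN⟩ := hl q.1
      obtain ⟨K, hK⟩ := hA q.1 u
      have h1 := mulSub_iterate_apply N (fun m n => B m * A q.1 n - ε • (A q.1 n * B m)) u
      rw [hN] at h1
      have h2 : (mulSub^[N] fun m n => B m (A q.1 n u)) = 0 := by
        have h3 : (fun m n => B m (A q.1 n u)) = fun m n =>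
            (B m * A q.1 n - ε • (A q.1 n * B m)) u := by
          ext m n
          simp [ih]
        rw [h3, h1]
        ext m n
        simp
      have h3 := eq_zero_of_mulSub_iterate
        (fun m n hn => by rw [hK n hn, map_zero] : ∀ m n, K ≤ n → B m (A q.1 n u) = 0) h2
      simpa using congrFun (congrFun h3 n) q.2
  ext n v
  have hv : v ∈ Submodule.span F
      (Set.range fun l : List (J × ℤ) => (l.map fun q => A q.1 q.2).prod vac) := by
    rw [hc]; trivial
  have hle : Submodule.span F
      (Set.range fun l : List (J × ℤ) => (l.map fun q => A q.1 q.2).prod vac) ≤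
      LinearMap.ker (B n) := by
    rw [Submodule.span_le]
    rintro _ ⟨l, rfl⟩
    exact hprod l n
  exact hle hv

end SignedLocality

end VertexSuperalgebra

namespace VertexSuperalgebra

open FormalDistribution

/-! ### Parity components of operators and fields -/

section Parity

variable {F V : Type*} [Field F] [AddCommGroup V] [Module F V]
  {part : ZMod 2 → Submodule F V}

/-- Two vectors of different parity with zero sum vanish. -/
theorem eq_zero_of_parity_sum (hc : IsCompl (part 0) (part 1)) {v : ZMod 2 → V} (r : ZMod 2)
    (hv : ∀ p, v p ∈ part (p + r)) (h : v 0 + v 1 = 0) (p : ZMod 2) : v p = 0 := by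
  have key : ∀ x y : V, x ∈ part 0 → y ∈ part 1 → x + y = 0 → x = 0 ∧ y = 0 := by
    intro x y hx hy hxy
    have hx' : x ∈ part 1 := by
      rw [eq_neg_of_add_eq_zero_left hxy]
      exact neg_mem hy
    have : x = 0 := by
      have := hc.disjoint.le_bot ⟨hx, hx'⟩
      simpa using this
    exact ⟨this, by simpa [this] using hxy⟩
  have h0 := hv 0
  have h1 := hv 1
  have hk : v 0 = 0 ∧ v 1 = 0 := by
    rcases r.eq_zero_or_one_of_two with rfl | rfl
    · exact key _ _ h0 h1 h
    · exact (key _ _ (by rwa [show (1 + 1 : ZMod 2) = 0 from rfl] at h1) (by simpa using h0)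
        (by rwa [add_comm])).symm
  rcases p.eq_zero_or_one_of_two with rfl | rfl
  exacts [hk.1, hk.2]

theorem eq_zero_of_forall_part (hc : IsCompl (part 0) (part 1)) {V' : Type*} [AddCommGroup V']
    [Module F V'] {f : V →ₗ[F] V'} (h : ∀ i, ∀ v ∈ part i, f v = 0) : f = 0 := by
  have : part 0 ⊔ part 1 ≤ LinearMap.ker f := sup_le (h 0) (h 1)
  rw [hc.sup_eq_top] at this
  exact LinearMap.ker_eq_top.mp (top_le_iff.mp this)

/-- The operators of parity `p`. -/
def endPart (part : ZMod 2 → Submodule F V) (p : ZMod 2) : Submodule F (Module.End F V) where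
  carrier := {f | ∀ i v, v ∈ part i → f v ∈ part (p + i)}
  add_mem' hf hg i v hv := add_mem (hf i v hv) (hg i v hv)
  zero_mem' _ _ _ := zero_mem _
  smul_mem' c _ hf i v hv := Submodule.smul_mem _ c (hf i v hv)

theorem mul_mem_endPart {p q : ZMod 2} {f g : Module.End F V} (hf : f ∈ endPart part p)
    (hg : g ∈ endPart part q) : f * g ∈ endPart part (p + q) := by
  intro i v hv
  rw [add_assoc]
  exact hf _ _ (hg _ _ hv)

theorem endPart_eq_zero (hc : IsCompl (part 0) (part 1)) {f : ZMod 2 → Module.End F V}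
    (r : ZMod 2) (hf : ∀ p, f p ∈ endPart part (p + r)) (h : f 0 + f 1 = 0) (p : ZMod 2) :
    f p = 0 := by
  refine eq_zero_of_forall_part hc fun i v hv => ?_
  refine eq_zero_of_parity_sum hc (v := fun p => f p v) (r + i) (fun p => ?_) ?_ p
  · rw [← add_assoc]
    exact hf p i v hv
  · simpa using LinearMap.congr_fun h v

theorem HasParity.mem {p : ZMod 2} {A : ℤ → Module.End F V} (h : HasParity part p A) (n : ℤ) :
    A n ∈ endPart part p := h n

/-- Parity components are unique, so the choice of components in `IsLocalPair` is immaterial. -/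
theorem eq_of_parity_add_eq (hc : IsCompl (part 0) (part 1))
    {A B : ZMod 2 → ℤ → Module.End F V} (hA : ∀ p, HasParity part p (A p))
    (hB : ∀ p, HasParity part p (B p)) (h : A 0 + A 1 = B 0 + B 1) : A = B := by
  ext p n : 2
  have h1 := endPart_eq_zero hc (f := fun p => A p n - B p n) 0
    (fun p => by rw [add_zero]; exact sub_mem ((hA p).mem n) ((hB p).mem n)) (by
      have := congrFun h n
      simp only [Pi.add_apply] at this
      rw [sub_add_sub_comm, this, sub_self]) p
  exact sub_eq_zero.mp h1

theorem hasParity_zero (p : ZMod 2) : HasParity part p (0 : ℤ → Module.End F V) :=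
  fun _ _ _ _ => zero_mem _

/-- The family whose only non-zero member is `A`, in parity `p`. -/
theorem hasParity_single {p : ZMod 2} {A : ℤ → Module.End F V} (h : HasParity part p A)
    (q : ZMod 2) : HasParity part q (Pi.single (M := fun _ => ℤ → Module.End F V) p A q) := by
  by_cases hq : q = p
  · subst hq
    rwa [Pi.single_eq_same]
  · rw [Pi.single_eq_of_ne hq]
    exact hasParity_zero q

theorem single_zero_add_single_one {M : Type*} [AddCommMonoid M] (p : ZMod 2) (A : M) :
    Pi.single (M := fun _ => M) p A 0 + Pi.single (M := fun _ => M) p A 1 = A := by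
  rcases p.eq_zero_or_one_of_two with rfl | rfl
  · rw [Pi.single_eq_same, Pi.single_eq_of_ne (by decide), add_zero]
  · rw [Pi.single_eq_same, Pi.single_eq_of_ne (by decide), zero_add]

theorem isLocalPair_of_components {A B : ZMod 2 → ℤ → Module.End F V}
    (hA : ∀ p, HasParity part p (A p)) (hB : ∀ p, HasParity part p (B p))
    (h : ∀ p q, IsSignedLocal (superSign p q) (A p) (B q)) :
    IsLocalPair part (A 0 + A 1) (B 0 + B 1) :=
  ⟨A, B, hA, hB, rfl, rfl, IsLocal.sum _ fun p _ => IsLocal.sum _ fun q _ => h p q⟩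

theorem isLocalPair_of_hasParity {A : ZMod 2 → ℤ → Module.End F V} {B : ℤ → Module.End F V}
    {q : ZMod 2} (hA : ∀ p, HasParity part p (A p)) (hB : HasParity part q B)
    (h : ∀ p, IsSignedLocal (superSign p q) (A p) B) :
    IsLocalPair part (A 0 + A 1) B := by
  have := isLocalPair_of_components hA (hasParity_single hB) (fun p q' => by
    by_cases hq : q' = q
    · subst hq
      rw [Pi.single_eq_same]
      exact h p
    · rw [Pi.single_eq_of_ne hq]
      exact isSignedLocal_zero_right)
  rwa [single_zero_add_single_one] at this

/-- The commutators of the even and the odd component of A with the homogeneous B have opposite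
parities. If (z-w)ᴺ kills their sum, it therefore kills each of them. -/
theorem IsLocalPair.exists_components (hc : IsCompl (part 0) (part 1))
    {A B : ℤ → Module.End F V} {q : ZMod 2} (hB : HasParity part q B)
    (h : IsLocalPair part A B) :
    ∃ A' : ZMod 2 → ℤ → Module.End F V, (∀ p, HasParity part p (A' p)) ∧ A = A' 0 + A' 1 ∧
      ∀ p, IsSignedLocal (superSign p q) (A' p) B := by
  obtain ⟨A', B', hA', hB', rfl, hBB, N, hN⟩ := h
  have hB'' : B' = Pi.single q B := eq_of_parity_add_eq hc hB' (hasParity_single hB)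
    (by rw [← hBB, single_zero_add_single_one])
  refine ⟨A', hA', rfl, fun p => ⟨N, ?_⟩⟩
  have e : (fun m n => ∑ p, ∑ r, (A' p m * B' r n - superSign p r • (B' r n * A' p m))) =
      (fun m n => A' 0 m * B n - superSign 0 q • (B n * A' 0 m)) +
      fun m n => A' 1 m * B n - superSign 1 q • (B n * A' 1 m) := by
    ext m n : 2
    rw [ZMod.sum_two]
    have hr : ∀ p, ∑ r, (A' p m * B' r n - superSign p r • (B' r n * A' p m)) =
        A' p m * B n - superSign p q • (B n * A' p m) := by
      intro p
      rw [Finset.sum_eq_single q, hB'', Pi.single_eq_same]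
      · intro r _ hr
        rw [hB'', Pi.single_eq_of_ne hr]
        simp
      · simp
    rw [hr, hr]
    rfl
  rw [e, mulSub_iterate_add] at hN
  ext m n : 2
  refine endPart_eq_zero hc (f := fun p =>
    mulSub^[N] (fun m n => A' p m * B n - superSign p q • (B n * A' p m)) m n) q
    (fun p => ?_) (congrFun (congrFun hN m) n) p
  refine mulSub_iterate_mem (endPart part (p + q)).toAddSubgroup (fun m n => ?_) N m n
  refine sub_mem (mul_mem_endPart ((hA' p).mem m) (hB.mem n)) (zsmul_mem ?_ _)
  rw [add_comm]
  exact mul_mem_endPart (hB.mem n) ((hA' p).mem m)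

theorem IsLocalPair.isSignedLocal (hc : IsCompl (part 0) (part 1))
    {A B : ℤ → Module.End F V} {p q : ZMod 2} (hA : HasParity part p A)
    (hB : HasParity part q B) (h : IsLocalPair part A B) :
    IsSignedLocal (superSign p q) A B := by
  obtain ⟨A', hA', hAA, hl⟩ := h.exists_components hc hB
  have hA'' : A' = Pi.single p A := eq_of_parity_add_eq hc hA' (hasParity_single hA)
    (by rw [← hAA, single_zero_add_single_one])
  have := hl p
  rwa [hA'', Pi.single_eq_same] at this

theorem isQuantumField_components (hc : IsCompl (part 0) (part 1))
    {A : ZMod 2 → ℤ → Module.End F V} (hA : ∀ p, HasParity part p (A p))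
    (h : IsQuantumField (A 0 + A 1)) (p : ZMod 2) : IsQuantumField (A p) := by
  have key : ∀ i, ∀ v ∈ part i, ∃ N : ℤ, ∀ n, N ≤ n → A p n v = 0 := by
    intro i v hv
    obtain ⟨N, hN⟩ := h v
    exact ⟨N, fun n hn => eq_zero_of_parity_sum hc (v := fun p => A p n v) i
      (fun p => hA p n i v hv) (hN n hn) p⟩
  intro v
  obtain ⟨x, hx, y, hy, rfl⟩ := Submodule.mem_sup.mp
    (show v ∈ part 0 ⊔ part 1 by rw [hc.sup_eq_top]; trivial)
  obtain ⟨N, hN⟩ := key 0 x hx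
  obtain ⟨M, hM⟩ := key 1 y hy
  exact ⟨max N M, fun n hn => by rw [map_add, hN n (by lia), hM n (by lia), add_zero]⟩

theorem isTranslationCovariant_components (hc : IsCompl (part 0) (part 1))
    {T : Module.End F V} (hT : ∀ i v, v ∈ part i → T v ∈ part i)
    {A : ZMod 2 → ℤ → Module.End F V} (hA : ∀ p, HasParity part p (A p))
    (h : IsTranslationCovariant T (A 0 + A 1)) (p : ZMod 2) :
    IsTranslationCovariant T (A p) := by
  have hT' : T ∈ endPart part 0 := fun i v hv => by rw [zero_add]; exact hT i v hv
  ext1 n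
  have := endPart_eq_zero hc (f := fun p => T * A p n - A p n * T - dz (A p) n) 0
    (fun p => ?_) ?_ p
  · exact sub_eq_zero.mp this
  · refine sub_mem (sub_mem ?_ (mul_mem_endPart ((hA p).mem n) hT')) ?_
    · rw [add_comm]
      exact mul_mem_endPart hT' ((hA p).mem n)
    · rw [add_zero]
      exact neg_mem (zsmul_mem ((hA p).mem _) _)
  · have h1 := sub_eq_zero.mpr (congrFun h n)
    rw [← h1]
    simp only [dz, Pi.add_apply, mul_add, add_mul, smul_add]
    abel

end Parity

/-! ### The Extension theorem -/

section Extension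

variable {F V J : Type*} [Field F] [AddCommGroup V] [Module F V]

/-- The translation covariant quantum fields of parity `p` that are local to the fields `Aʲ(z)`
of parity `π j`. -/
def localFields (part : ZMod 2 → Submodule F V) (T : Module.End F V)
    (A : J → ℤ → Module.End F V) (π : J → ZMod 2) (p : ZMod 2) :
    Submodule F (ℤ → Module.End F V) where
  carrier := {B | HasParity part p B ∧ IsQuantumField B ∧ IsTranslationCovariant T B ∧
    ∀ j, IsSignedLocal (superSign p (π j)) B (A j)}
  add_mem' := by
    rintro B C ⟨h1, h2, h3, h4⟩ ⟨h1', h2', h3', h4'⟩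
    refine ⟨fun n => add_mem (h1.mem n) (h1'.mem n), fun v => ?_, ?_,
      fun j => (h4 j).add_left (h4' j)⟩
    · obtain ⟨N, hN⟩ := h2 v
      obtain ⟨M, hM⟩ := h2' v
      exact ⟨max N M, fun n hn => by
        rw [Pi.add_apply, LinearMap.add_apply, hN n (by lia), hM n (by lia), add_zero]⟩
    · ext1 n
      have e1 := congrFun h3 n
      have e2 := congrFun h3' n
      simp only [dz, Pi.add_apply, mul_add, add_mul, smul_add, neg_add] at e1 e2 ⊢
      rw [← e1, ← e2]
      abel
  zero_mem' := by
    refine ⟨hasParity_zero p, fun v => ⟨0, fun n _ => rfl⟩, ?_, fun j => isSignedLocal_zero_left⟩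
    ext1 n
    simp [dz]
  smul_mem' := by
    rintro c B ⟨h1, h2, h3, h4⟩
    refine ⟨fun n => Submodule.smul_mem _ c (h1.mem n), fun v => ?_, ?_,
      fun j => (h4 j).smul_left c⟩
    · obtain ⟨N, hN⟩ := h2 v
      exact ⟨N, fun n hn => by
        rw [Pi.smul_apply, LinearMap.smul_apply, hN n hn, smul_zero]⟩
    · ext1 n
      have e1 := congrFun h3 n
      simp only [dz, Pi.smul_apply, mul_smul_comm, smul_mul_assoc] at e1 ⊢
      rw [← smul_sub, e1, smul_neg, smul_comm]

variable {part : ZMod 2 → Submodule F V} {vac : V} {T : Module.End F V}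
  {A : J → ℤ → Module.End F V} {π : J → ZMod 2}

theorem dz_mem_localFields {p : ZMod 2} {B : ℤ → Module.End F V}
    (hB : B ∈ localFields part T A π p) : dz B ∈ localFields part T A π p := by
  obtain ⟨h1, h2, h3, h4⟩ := hB
  exact ⟨fun n => neg_mem (zsmul_mem (h1.mem _) _), h2.dz, h3.dz, fun j => (h4 j).dz_left⟩

/-- The constant field `I_V`. -/
def idField (F V : Type*) [Field F] [AddCommGroup V] [Module F V] : ℤ → Module.End F V :=
  fun n => if n = -1 then 1 else 0

theorem isSignedLocal_idField (B : ℤ → Module.End F V) : IsSignedLocal 1 (idField F V) B := by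
  refine ⟨0, ?_⟩
  ext m n : 2
  by_cases h : m = -1 <;> simp [idField, h]

theorem superSign_zero_left (q : ZMod 2) : superSign 0 q = 1 := by
  revert q; decide

theorem idField_mem_localFields : idField F V ∈ localFields part T A π 0 := by
  refine ⟨fun n i v hv => ?_, fun v => ⟨0, fun n hn => ?_⟩, ?_, fun j => ?_⟩
  · rw [zero_add]
    by_cases h : n = -1
    · simpa [idField, h] using hv
    · simp [idField, h]
  · rw [idField, if_neg (by lia), LinearMap.zero_apply]
  · ext1 n
    rcases eq_or_ne n 0 with rfl | h0
    · simp [idField, dz]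
    · have h' : n - 1 ≠ -1 := by lia
      by_cases h : n = -1 <;> simp [idField, dz, h, h']
  · rw [superSign_zero_left]
    exact isSignedLocal_idField _

theorem localFields_eq_zero [CharZero F] (hV : IsPreVertex part vac T A) {p : ZMod 2}
    {B : ℤ → Module.End F V} (hB : B ∈ localFields part T A π p) (h0 : B (-1) vac = 0) : B = 0 :=
  eq_zero_of_apply_vac hV.T_vac hV.isQuantumField hV.completeness hB.2.2.1 hB.2.1
    (fun j => ⟨_, hB.2.2.2 j⟩) h0

theorem localFields_apply_mem (hV : IsPreVertex part vac T A) {p : ZMod 2}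
    {B : ℤ → Module.End F V} (hB : B ∈ localFields part T A π p) (n : ℤ) : B n vac ∈ part p := by
  have := hB.1 n 0 vac hV.vac_even
  rwa [add_zero] at this

theorem localFields_eq_zero_of_sum [CharZero F] (hV : IsPreVertex part vac T A)
    {C : ZMod 2 → ℤ → Module.End F V}
    (hC : ∀ p, C p ∈ localFields part T A π p) (h : C 0 (-1) vac + C 1 (-1) vac = 0) : C = 0 := by
  ext1 p
  refine localFields_eq_zero hV (hC p) ?_
  exact eq_zero_of_parity_sum hV.isCompl (v := fun p => C p (-1) vac) 0
    (fun p => by rw [add_zero]; exact localFields_apply_mem hV (hC p) _) h p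

theorem localFields_eq_of_sum [CharZero F] (hV : IsPreVertex part vac T A)
    {C C' : ZMod 2 → ℤ → Module.End F V}
    (hC : ∀ p, C p ∈ localFields part T A π p) (hC' : ∀ p, C' p ∈ localFields part T A π p)
    (h : C 0 (-1) vac + C 1 (-1) vac = C' 0 (-1) vac + C' 1 (-1) vac) : C = C' := by
  refine sub_eq_zero.mp (localFields_eq_zero_of_sum hV (C := C - C')
    (fun p => sub_mem (hC p) (hC' p)) ?_)
  simp only [Pi.sub_apply, LinearMap.sub_apply]
  rw [sub_add_sub_comm, h, sub_self]

variable (hV : IsPreVertex part vac T A) (hπ : ∀ j, HasParity part (π j) (A j))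
include hV hπ

theorem mem_localFields (j : J) : A j ∈ localFields part T A π (π j) :=
  ⟨hπ j, hV.isQuantumField j, hV.translation j, fun i =>
    (hV.isLocal j i).isSignedLocal hV.isCompl (hπ j) (hπ i)⟩

theorem mem_Fmax_iff {B : ℤ → Module.End F V} :
    B ∈ Fmax part T A ↔ ∃ C : ZMod 2 → ℤ → Module.End F V,
      (∀ p, C p ∈ localFields part T A π p) ∧ B = C 0 + C 1 := by
  constructor
  · rintro ⟨h1, h2, h3⟩
    obtain ⟨C, hC, rfl⟩ : ∃ C : ZMod 2 → ℤ → Module.End F V,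
        (∀ p, HasParity part p (C p)) ∧ B = C 0 + C 1 := by
      -- A splitting of B into parity components is read off from locality with any one generator.
      -- Without generators V is spanned by the vacuum, so it is purely even and B is its own even
      -- component.
      rcases isEmpty_or_nonempty J with hJ | ⟨⟨j⟩⟩
      · have h0 : part 0 = ⊤ := by
          rw [← top_le_iff, ← hV.completeness, Submodule.span_le]
          rintro _ ⟨l, rfl⟩
          cases l with
          | nil => exact hV.vac_even
          | cons q l => exact hJ.elim q.1
        have h1 : part 1 = ⊥ := by
          have := hV.isCompl.inf_eq_bot
          rwa [h0, top_inf_eq] at this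
        refine ⟨Pi.single 0 B, hasParity_single fun n i v hv => ?_,
          (single_zero_add_single_one 0 B).symm⟩
        rcases i.eq_zero_or_one_of_two with rfl | rfl
        · rw [add_zero, h0]; trivial
        · rw [h1, Submodule.mem_bot] at hv
          rw [hv, map_zero]
          exact zero_mem _
      · obtain ⟨C, hC, hB, -⟩ := (h3 j).exists_components hV.isCompl (hπ j)
        exact ⟨C, hC, hB⟩
    refine ⟨C, fun p => ⟨hC p, isQuantumField_components hV.isCompl hC h1 p,
      isTranslationCovariant_components hV.isCompl hV.T_even hC h2 p, fun j => ?_⟩, rfl⟩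
    obtain ⟨C', hC', hB, hl⟩ := (h3 j).exists_components hV.isCompl (hπ j)
    rw [eq_of_parity_add_eq hV.isCompl hC hC' hB]
    exact hl p
  · rintro ⟨C, hC, rfl⟩
    have hT : IsTranslationCovariant T (C 0 + C 1) := by
      ext1 n
      have e1 := congrFun (hC 0).2.2.1 n
      have e2 := congrFun (hC 1).2.2.1 n
      simp only [dz, Pi.add_apply, mul_add, add_mul, smul_add, neg_add] at e1 e2 ⊢
      rw [← e1, ← e2]
      abel
    refine ⟨fun v => ?_, hT, fun j =>
      isLocalPair_of_hasParity (fun p => (hC p).1) (hπ j) fun p => (hC p).2.2.2 j⟩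
    obtain ⟨N, hN⟩ := (hC 0).2.1 v
    obtain ⟨M, hM⟩ := (hC 1).2.1 v
    exact ⟨max N M, fun n hn => by
      rw [Pi.add_apply, LinearMap.add_apply, hN n (by lia), hM n (by lia), add_zero]⟩

variable [CharZero F]

/-- Surjectivity of the map from fields to vectors: the n-th product of Aʲ with a field for u yields
a field for Aʲ₍ₙ₎u. Locality with an extra field D is carried through the induction by Dong's lemma;
it is what later gives mutual locality of all fields. -/
theorem exists_localFields {q : ZMod 2} {D : ℤ → Module.End F V}
    (hD : D ∈ localFields part T A π q) (v : V) :
    ∃ C : ZMod 2 → ℤ → Module.End F V, (∀ p, C p ∈ localFields part T A π p) ∧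
      (∀ p, IsSignedLocal (superSign p q) (C p) D) ∧ C 0 (-1) vac + C 1 (-1) vac = v := by
  have hv : v ∈ Submodule.span F
      (Set.range fun l : List (J × ℤ) => (l.map fun q => A q.1 q.2).prod vac) := by
    rw [hV.completeness]; trivial
  have hprod : ∀ l : List (J × ℤ), ∃ p, ∃ C ∈ localFields part T A π p,
      IsSignedLocal (superSign p q) C D ∧
      C (-1) vac = (l.map fun q => A q.1 q.2).prod vac := by
    intro l
    induction l with
    | nil =>
      refine ⟨0, idField F V, idField_mem_localFields, ?_, by simp [idField]⟩
      rw [superSign_zero_left]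
      exact isSignedLocal_idField _
    | cons x l ih =>
      obtain ⟨p, C, hC, hl, hs⟩ := ih
      have hA := mem_localFields hV hπ x.1
      obtain ⟨k, E, h1, h2, h3, h4, h5⟩ := exists_nth_product (vac := vac) hA.2.1 hC.2.1
        hA.2.2.1 hC.2.2.1 (apply_vac_nonneg hV.T_vac hA.2.2.1 hA.2.1)
        (apply_vac_nonneg hV.T_vac hC.2.2.1 hC.2.1)
        ((hC.2.2.2 x.1).symm (superSign_mul_self _ _)) x.2
      have hE : E ∈ localFields part T A π (π x.1 + p) := by
        refine ⟨h4 part _ _ hA.1 hC.1, h1, h2, fun j => ?_⟩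
        rw [superSign_add_left]
        exact h5 _ _ _ (hA.2.2.2 j) (hC.2.2.2 j)
      -- The field E produces k! times the required vector; characteristic zero permits division.
      refine ⟨π x.1 + p, ((k.factorial : F)⁻¹) • E, Submodule.smul_mem _ _ hE,
        IsSignedLocal.smul_left _ ?_, ?_⟩
      · rw [superSign_add_left]
        refine h5 _ _ _ ?_ hl
        rw [superSign_comm]
        exact (hD.2.2.2 x.1).symm (superSign_mul_self _ _)
      · rw [Pi.smul_apply, LinearMap.smul_apply, h3, hs, ← Int.cast_smul_eq_zsmul F, smul_smul,
          Int.cast_natCast, inv_mul_cancel₀ (by exact_mod_cast k.factorial_ne_zero), one_smul]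
        simp
  induction hv using Submodule.span_induction with
  | mem v hv =>
    obtain ⟨l, rfl⟩ := hv
    obtain ⟨p, C, hC, hl, hs⟩ := hprod l
    refine ⟨Pi.single p C, fun r => ?_, fun r => ?_, ?_⟩
    · by_cases hr : r = p
      · subst hr
        rwa [Pi.single_eq_same]
      · rw [Pi.single_eq_of_ne hr]
        exact zero_mem _
    · by_cases hr : r = p
      · subst hr
        rwa [Pi.single_eq_same]
      · rw [Pi.single_eq_of_ne hr]
        exact isSignedLocal_zero_left
    · have h := LinearMap.congr_fun (congrFun (single_zero_add_single_one p C) (-1)) vac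
      exact h.trans hs
  | zero =>
    exact ⟨0, fun p => zero_mem _, fun p => isSignedLocal_zero_left, by simp⟩
  | add u v _ _ hu hv =>
    obtain ⟨C, hC, hCl, rfl⟩ := hu
    obtain ⟨C', hC', hCl', rfl⟩ := hv
    refine ⟨C + C', fun p => add_mem (hC p) (hC' p), fun p => (hCl p).add_left (hCl' p), ?_⟩
    simp only [Pi.add_apply, LinearMap.add_apply]
    abel
  | smul c v _ hv =>
    obtain ⟨C, hC, hCl, rfl⟩ := hv
    refine ⟨c • C, fun p => Submodule.smul_mem _ _ (hC p), fun p => (hCl p).smul_left c, ?_⟩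
    simp only [Pi.smul_apply, LinearMap.smul_apply, smul_add]

/-- A field local to D with the same vacuum value as C exists, and by uniqueness its component of
parity p is C. -/
theorem isSignedLocal_localFields {p q : ZMod 2} {C D : ℤ → Module.End F V}
    (hC : C ∈ localFields part T A π p) (hD : D ∈ localFields part T A π q) :
    IsSignedLocal (superSign p q) C D := by
  obtain ⟨E, hE, hl, hs⟩ := exists_localFields hV hπ hD (C (-1) vac)
  have h := localFields_eq_of_sum hV (C := Pi.single p C) (fun r => by
    by_cases hr : r = p
    · subst hr
      rwa [Pi.single_eq_same]
    · rw [Pi.single_eq_of_ne hr]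
      exact zero_mem _) hE
    ((LinearMap.congr_fun (congrFun (single_zero_add_single_one p C) (-1)) vac).trans hs.symm)
  have := hl p
  rwa [← h, Pi.single_eq_same] at this

/-- The Extension theorem. -/
theorem exists_isVertexSuperalgebra :
    ∃ Y : V →ₗ[F] ℤ → Module.End F V, IsVertexSuperalgebra part vac T Y ∧
      Set.range Y = Fmax part T A ∧ ∀ j, Y (A j (-1) vac) = A j := by
  let M := localFields part T A π 0 ⊔ localFields part T A π 1
  have hM : ∀ B, B ∈ M ↔ ∃ C : ZMod 2 → ℤ → Module.End F V,
      (∀ p, C p ∈ localFields part T A π p) ∧ B = C 0 + C 1 := by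
    intro B
    rw [Submodule.mem_sup]
    constructor
    · rintro ⟨x, hx, y, hy, rfl⟩
      refine ⟨fun p => if p = 0 then x else y, fun p => ?_, by simp⟩
      rcases p.eq_zero_or_one_of_two with rfl | rfl
      · simpa using hx
      · simpa using hy
    · rintro ⟨C, hC, rfl⟩
      exact ⟨C 0, hC 0, C 1, hC 1, rfl⟩
  let s : M →ₗ[F] V := (LinearMap.applyₗ vac ∘ₗ LinearMap.proj (-1)) ∘ₗ M.subtype
  have hs : ∀ B : M, s B = B.1 (-1) vac := fun _ => rfl
  have hbij : Function.Bijective s := by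
    constructor
    · rw [injective_iff_map_eq_zero]
      rintro ⟨B, hB⟩ h0
      obtain ⟨C, hC, rfl⟩ := (hM B).mp hB
      have := localFields_eq_zero_of_sum hV hC h0
      ext1
      simp [this]
    · intro v
      -- Only existence matters here, so the extra field D is taken to be 0.
      obtain ⟨C, hC, -, h⟩ := exists_localFields hV hπ
        (zero_mem (localFields part T A π 0)) v
      exact ⟨⟨C 0 + C 1, (hM _).mpr ⟨C, hC, rfl⟩⟩, h⟩
  let e := LinearEquiv.ofBijective s hbij
  let Y : V →ₗ[F] ℤ → Module.End F V := M.subtype ∘ₗ e.symm.toLinearMap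
  have hYM : ∀ v, Y v ∈ M := fun v => (e.symm v).2
  have hYv : ∀ v, Y v (-1) vac = v := fun v => e.apply_symm_apply v
  have hYB : ∀ B ∈ M, Y (B (-1) vac) = B := fun B hB =>
    congrArg Subtype.val (e.symm_apply_apply ⟨B, hB⟩)
  have hmem : ∀ p, ∀ B ∈ localFields part T A π p, B ∈ M := by
    intro p B hB
    rcases p.eq_zero_or_one_of_two with rfl | rfl
    · exact Submodule.mem_sup_left hB
    · exact Submodule.mem_sup_right hB
  have hYmax : ∀ v, Y v ∈ Fmax part T A := fun v =>
    (mem_Fmax_iff hV hπ).mpr ((hM _).mp (hYM v))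
  refine ⟨Y, ?_, ?_, fun j => hYB _ (hmem _ _ (mem_localFields hV hπ j))⟩
  · refine
      { isCompl := hV.isCompl
        vac_ne_zero := hV.vac_ne_zero
        T_even := hV.T_even
        parity := ?_
        isQuantumField := fun v => (hYmax v).1
        Y_vac := ?_
        Y_apply_vac_nonneg := fun v =>
          apply_vac_nonneg hV.T_vac (hYmax v).2.1 (hYmax v).1
        Y_apply_vac_neg_one := hYv
        Y_apply_vac_neg_two := fun v => by
          rw [apply_vac_neg_two hV.T_vac (hYmax v).2.1, hYv]
        translation := fun v => (hYmax v).2.1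
        Y_T := ?_
        isLocal := ?_ }
    · intro i v hv
      obtain ⟨C, hC, -, h⟩ := exists_localFields hV hπ
        (zero_mem (localFields part T A π 0)) v
      -- Since v has parity i, comparing parities leaves only the i-th component, and Y v is that
      -- homogeneous field.
      have hd : C i (-1) vac = v := by
        have h1 := eq_zero_of_parity_sum hV.isCompl
          (v := fun p => C p (-1) vac - Pi.single (M := fun _ => V) i v p) 0 (fun p => by
            rw [add_zero]
            refine sub_mem (localFields_apply_mem hV (hC p) _) ?_
            by_cases hp : p = i
            · subst hp
              rwa [Pi.single_eq_same]
            · rw [Pi.single_eq_of_ne hp]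
              exact zero_mem _) (by
            rw [sub_add_sub_comm, h, single_zero_add_single_one, sub_self]) i
        simpa [sub_eq_zero] using h1
      have := hYB (C i) (hmem _ _ (hC i))
      rw [hd] at this
      rw [this]
      exact (hC i).1
    · have h := hYB _ (hmem _ _ (idField_mem_localFields (part := part) (T := T) (A := A) (π := π)))
      have h1 : idField F V (-1) vac = vac := by simp [idField]
      rw [h1] at h
      intro n
      rw [h, idField]
    · intro v
      -- The derivative is again in M and has vacuum value T v, so uniqueness identifies it with Y
      -- (T v).
      have hd : dz (Y v) ∈ M := by
        obtain ⟨C, hC, h⟩ := (hM _).mp (hYM v)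
        refine (hM _).mpr ⟨fun p => dz (C p), fun p => dz_mem_localFields (hC p), ?_⟩
        rw [h]
        ext1 n
        simp only [dz, Pi.add_apply, smul_add, neg_add]
      have h := hYB _ hd
      have h1 : dz (Y v) (-1) vac = T v := by
        have h2 := apply_vac_neg_two hV.T_vac (hYmax v).2.1
        rw [hYv] at h2
        rw [← h2]
        simp [dz]
      rwa [h1] at h
    · intro u v
      obtain ⟨C, hC, h⟩ := (hM _).mp (hYM u)
      obtain ⟨D, hD, h'⟩ := (hM _).mp (hYM v)
      rw [h, h']
      exact isLocalPair_of_components (fun p => (hC p).1) (fun p => (hD p).1)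
        fun p q => isSignedLocal_localFields hV hπ (hC p) (hD q)
  · ext B
    rw [mem_Fmax_iff hV hπ, ← hM]
    constructor
    · rintro ⟨v, rfl⟩
      exact hYM v
    · intro hB
      exact ⟨_, hYB B hB⟩

end Extension

end VertexSuperalgebra

/-! ### Truncation of a local distribution from its residues -/

namespace FormalDistribution

/-- If the residues `Res (z-w)^k c(z,w) dz` of a local distribution have coefficients that vanish
from some index on, then so does `c(z,w)` in total degree. -/
theorem exists_bound_of_residues {U : Type*} [AddCommGroup U] {c : ℤ → ℤ → U} {N : ℕ}
    (hN : mulSub^[N] c = 0) (h : ∀ k, ∃ K : ℤ, ∀ l, K ≤ l → mulSub^[k] c 0 l = 0) :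
    ∃ K : ℤ, ∀ (m : ℕ) (n : ℤ), K ≤ m + n → c m n = 0 := by
  induction N generalizing c with
  | zero =>
    have h0 : c = 0 := hN
    exact ⟨0, fun m n _ => by simp [h0]⟩
  | succ N ih =>
    obtain ⟨K, hK⟩ := ih (c := mulSub c) hN fun k => h (k + 1)
    obtain ⟨K', hK'⟩ := h 0
    -- In large total degree (z-w)c vanishes, so c(m+1, n) = c(m, n+1). Repeating this lowers the
    -- first index to 0, where the residue of c itself decides.
    refine ⟨max (K + 1) K', fun m => ?_⟩
    induction m with
    | zero => intro n hn; exact hK' n (by push_cast at hn; lia)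
    | succ m ihm =>
      intro n hn
      push_cast at hn
      have h1 := hK m n (by lia)
      rw [mulSub, ihm (n + 1) (by lia), sub_zero] at h1
      exact_mod_cast h1

end FormalDistribution

/-! ### The induced module satisfies the hypotheses of the Extension theorem -/

namespace LieSuperalgebra

open FormalDistribution VertexSuperalgebra

section

variable {F g J : Type*} [Field F] [AddCommGroup g] [Module F g] (L : LieSuperalgebra F g)
  (a : J → ℤ → g)

/-- A subspace of `U(g)` that contains `1` and is stable under left multiplication by `g` is
everything. -/
theorem env_submodule_eq_top (S : Submodule F L.Env) (h1 : 1 ∈ S)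
    (h : ∀ x, ∀ u ∈ S, L.ι x * u ∈ S) : S = ⊤ := by
  -- Stability of S under all of U(𝔤) is proved, with w arbitrary, so that the induction passes
  -- through products.
  have key : ∀ t : TensorAlgebra F g, ∀ w ∈ S, RingQuot.mkAlgHom F L.EnvRel t * w ∈ S := by
    intro t
    induction t using TensorAlgebra.induction with
    | algebraMap r =>
      intro w hw
      rw [AlgHom.commutes, ← Algebra.smul_def]
      exact S.smul_mem r hw
    | ι x => exact h x
    | mul u v hu hv =>
      intro w hw
      rw [map_mul, mul_assoc]
      exact hu _ (hv w hw)
    | add u v hu hv =>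
      intro w hw
      rw [map_add, add_mul]
      exact add_mem (hu w hw) (hv w hw)
  refine top_le_iff.mp fun u _ => ?_
  obtain ⟨t, rfl⟩ := RingQuot.mkAlgHom_surjective F L.EnvRel u
  have := key t 1 h1
  rwa [mul_one] at this

theorem toInd_surjective : Function.Surjective (L.toInd a) :=
  fun v => Submodule.Quotient.mk_surjective (L.leftIdeal a) v

theorem toInd_eq_zero_iff (u : L.Env) : L.toInd a u = 0 ↔ u ∈ L.leftIdeal a :=
  Submodule.Quotient.mk_eq_zero _

/-- A subspace of `V` that contains `|0⟩` and is stable under `g` is everything. -/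
theorem ind_submodule_eq_top (S : Submodule F (L.Ind a)) (h1 : L.vacuum a ∈ S)
    (h : ∀ x, ∀ v ∈ S, L.rep a x v ∈ S) : S = ⊤ := by
  have := L.env_submodule_eq_top (S.comap (L.toInd a)) h1 fun x u hu => h x _ hu
  refine top_le_iff.mp fun v _ => ?_
  obtain ⟨u, rfl⟩ := L.toInd_surjective a v
  have hu : u ∈ S.comap (L.toInd a) := by rw [this]; trivial
  exact hu

theorem map_supercommutator {R S : Type*} [Ring R] [Ring S] [Algebra F R] [Algebra F S]
    (φ : R →ₐ[F] S) {x y z : R} {s : ℤ} (h : x * y = s • (y * x) + z) :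
    φ x * φ y - s • (φ y * φ x) = φ z := by
  rw [← map_mul, h, map_add, map_zsmul, map_mul, add_sub_cancel_left]

theorem rep_bracket {i j : ZMod 2} {x y : g} (hx : x ∈ L.part i) (hy : y ∈ L.part j) :
    L.rep a x * L.rep a y - superSign i j • (L.rep a y * L.rep a x) = L.rep a (L.bracket x y) :=
  map_supercommutator (Algebra.lsmul F F (L.Ind a)) (L.ι_mul_ι i j x y hx hy)

theorem rep_vacuum_of_mem {x : g} (hx : x ∈ annihilation F a) : L.rep a x (L.vacuum a) = 0 := by
  rw [vacuum, rep_toInd, mul_one, toInd_eq_zero_iff]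
  exact Submodule.subset_span ⟨x, hx, rfl⟩

/-- The augmentation of U(𝔤), extending the zero map on 𝔤, kills the left ideal but sends 1 to 1. -/
theorem vacuum_ne_zero : L.vacuum a ≠ 0 := by
  let ε : L.Env →ₐ[F] F := L.lift 0 (by simp)
  intro h
  have h1 : (1 : L.Env) ∈ L.leftIdeal a := (L.toInd_eq_zero_iff a 1).mp h
  have h2 : ∀ u ∈ L.leftIdeal a, ε u = 0 := by
    intro u hu
    induction hu using Submodule.span_induction with
    | mem u hu =>
      obtain ⟨x, -, rfl⟩ := hu
      simp [ε]
    | zero => exact map_zero ε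
    | add u v _ _ hu hv => rw [map_add, hu, hv, add_zero]
    | smul c u _ hu => rw [smul_eq_mul, map_mul, hu, mul_zero]
  have := h2 1 h1
  rw [map_one] at this
  exact one_ne_zero this

/-! ### Parity -/

theorem one_mem_envPart : (1 : L.Env) ∈ L.envPart 0 :=
  Submodule.subset_span ⟨[], by simp, by simp, by simp⟩

theorem ι_mul_mem_envPart {i j : ZMod 2} {x : g} (hx : x ∈ L.part i) {u : L.Env}
    (hu : u ∈ L.envPart j) : L.ι x * u ∈ L.envPart (i + j) := by
  induction hu using Submodule.span_induction with
  | mem u hu =>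
    obtain ⟨l, hl, rfl, rfl⟩ := hu
    refine Submodule.subset_span ⟨(i, x) :: l, ?_, by simp, by simp⟩
    intro q hq
    rcases List.mem_cons.mp hq with rfl | hq
    exacts [hx, hl q hq]
  | zero => rw [mul_zero]; exact zero_mem _
  | add u v _ _ hu hv => rw [mul_add]; exact add_mem hu hv
  | smul c u _ hu => rw [mul_smul_comm]; exact Submodule.smul_mem _ c hu

theorem envDerivation_mem_envPart {T : g →ₗ[F] g} (hT : L.IsDerivation T) {i : ZMod 2}
    {u : L.Env} (hu : u ∈ L.envPart i) : L.envDerivation T hT u ∈ L.envPart i := by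
  have h1 : L.envDerivation T hT 1 = 0 := by
    have := L.envDerivation_mul T hT 1 1
    simpa using this
  have key : ∀ l : List (ZMod 2 × g), (∀ q ∈ l, q.2 ∈ L.part q.1) →
      (l.map fun q => L.ι q.2).prod ∈ L.envPart (l.map Prod.fst).sum ∧
      L.envDerivation T hT (l.map fun q => L.ι q.2).prod ∈ L.envPart (l.map Prod.fst).sum := by
    intro l
    induction l with
    | nil => exact fun _ => ⟨L.one_mem_envPart, by simp [h1]⟩
    | cons q l ih =>
      intro hl
      obtain ⟨h2, h3⟩ := ih fun r hr => hl r (List.mem_cons_of_mem _ hr)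
      have hq := hl q List.mem_cons_self
      simp only [List.map_cons, List.prod_cons, List.sum_cons]
      refine ⟨L.ι_mul_mem_envPart hq h2, ?_⟩
      rw [envDerivation_mul, envDerivation_ι]
      exact add_mem (L.ι_mul_mem_envPart (hT.even _ _ hq) h2) (L.ι_mul_mem_envPart hq h3)
  induction hu using Submodule.span_induction with
  | mem u hu =>
    obtain ⟨l, hl, rfl, rfl⟩ := hu
    exact (key l hl).2
  | zero => rw [map_zero]; exact zero_mem _
  | add u v _ _ hu hv => rw [map_add]; exact add_mem hu hv
  | smul c u _ hu => rw [map_smul]; exact Submodule.smul_mem _ c hu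

/-- The parity automorphism of `g`. -/
theorem exists_parity_map : ∃ θ : g →ₗ[F] g,
    ∀ i, ∀ x ∈ L.part i, θ x = superSign 1 i • x := by
  refine ⟨LinearMap.ofIsCompl L.isCompl (L.part 0).subtype (-(L.part 1).subtype), ?_⟩
  intro i x hx
  rcases i.eq_zero_or_one_of_two with rfl | rfl
  · have := LinearMap.ofIsCompl_apply_left L.isCompl (φ := (L.part 0).subtype)
      (ψ := -(L.part 1).subtype) ⟨x, hx⟩
    simpa [superSign] using this
  · have := LinearMap.ofIsCompl_apply_right L.isCompl (φ := (L.part 0).subtype)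
      (ψ := -(L.part 1).subtype) ⟨x, hx⟩
    simpa [superSign] using this

theorem smul_mul_smul_of_relation {R : Type*} [Ring R] {x y z : R} {s t t' : ℤ}
    (h : x * y = s • (y * x) + z) :
    (t • x) * (t' • y) = s • ((t' • y) * (t • x)) + (t * t') • z := by
  simp only [smul_mul_smul_comm, h, smul_add, smul_smul]
  ring_nf

theorem algHom_eq_smul_of_mem_span {R : Type*} [Ring R] [Algebra F R] (σ : R →ₐ[F] R) (s : ℤ)
    {X : Set R} (h : ∀ u ∈ X, σ u = s • u) {u : R} (hu : u ∈ Submodule.span F X) :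
    σ u = s • u := by
  induction hu using Submodule.span_induction with
  | mem u hu => exact h u hu
  | zero => rw [map_zero, smul_zero]
  | add u v _ _ hu hv => rw [map_add, hu, hv, smul_add]
  | smul c u _ hu => rw [map_smul, hu, smul_comm]

theorem smul_mul_of_eq {R : Type*} [Ring R] {x y x' y' : R} {s t : ℤ} (hx : x' = s • x)
    (hy : y' = t • y) : x' * y' = (s * t) • (x * y) := by
  rw [hx, hy, smul_mul_smul_comm]

/-- The subspaces `envPart` are defined as spans, so their independence is not evident. This
automorphism separates them by its eigenvalues ±1. -/
theorem exists_env_parity_hom : ∃ σ : L.Env →ₐ[F] L.Env,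
    (∀ i, ∀ x ∈ L.part i, σ (L.ι x) = superSign 1 i • L.ι x) ∧
    ∀ i, ∀ u ∈ L.envPart i, σ u = superSign 1 i • u := by
  have hsign : ∀ i j, superSign 1 (i + j) = superSign 1 i * superSign 1 j := fun i j => by
    rw [superSign_comm, superSign_add_left, superSign_comm i, superSign_comm j]
  obtain ⟨θ, hθ⟩ := L.exists_parity_map
  let σ : L.Env →ₐ[F] L.Env := L.lift (L.ι ∘ₗ θ) (by
    intro i j x y hx hy
    simp only [LinearMap.comp_apply]
    rw [hθ i x hx, hθ j y hy, hθ _ _ (L.bracket_mem i j x y hx hy), hsign]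
    simp only [map_zsmul]
    exact smul_mul_smul_of_relation (L.ι_mul_ι i j x y hx hy))
  have h1 : ∀ i, ∀ x ∈ L.part i, σ (L.ι x) = superSign 1 i • L.ι x := by
    intro i x hx
    simp [σ, hθ i x hx]
  refine ⟨σ, h1, fun i u hu => ?_⟩
  refine algHom_eq_smul_of_mem_span σ _ ?_ hu
  clear hu
  rintro _ ⟨l, hl, rfl, rfl⟩
  induction l with
  | nil => simp [superSign]
  | cons q l ih =>
    simp only [List.map_cons, List.prod_cons, List.sum_cons, map_mul]
    rw [hsign]
    exact smul_mul_of_eq (h1 _ _ (hl q List.mem_cons_self))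
      (ih fun r hr => hl r (List.mem_cons_of_mem _ hr))

variable {a}

theorem indPart_isCompl [CharZero F] (ha : ∀ j, ∃ p, ∀ n, a j n ∈ L.part p) :
    IsCompl (L.indPart a 0) (L.indPart a 1) := by
  constructor
  · obtain ⟨σ, h1, h2⟩ := L.exists_env_parity_hom
    -- The ideal is invariant because 𝔤₋ is spanned by homogeneous elements.
    have hI : ∀ u ∈ L.leftIdeal a, σ u ∈ L.leftIdeal a := by
      intro u hu
      induction hu using Submodule.span_induction with
      | mem u hu =>
        obtain ⟨x, hx, rfl⟩ := hu
        induction hx using Submodule.span_induction with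
        | mem x hx =>
          obtain ⟨⟨j, n⟩, rfl⟩ := hx
          obtain ⟨p, hp⟩ := ha j
          rw [h1 p _ (hp n)]
          have hmem : L.ι (a j n) ∈ L.leftIdeal a :=
            Submodule.subset_span ⟨_, Submodule.subset_span ⟨(j, n), rfl⟩, rfl⟩
          exact zsmul_mem hmem _
        | zero => simp
        | add x y _ _ hx hy => rw [map_add, map_add]; exact add_mem hx hy
        | smul c x _ hx =>
          rw [map_smul, map_smul, Algebra.smul_def]
          exact (L.leftIdeal a).smul_mem _ hx
      | zero => rw [map_zero]; exact zero_mem _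
      | add u v _ _ hu hv => rw [map_add]; exact add_mem hu hv
      | smul c u _ hu =>
        rw [smul_eq_mul, map_mul]
        exact (L.leftIdeal a).smul_mem _ hu
    rw [Submodule.disjoint_def]
    rintro _ ⟨u, hu, rfl⟩ ⟨w, hw, hwu⟩
    have hd : u - w ∈ L.leftIdeal a := by
      rw [← toInd_eq_zero_iff, map_sub, hwu, sub_self]
    -- With u even and w odd, σ(u-w) = u + w, so the ideal contains 2u and hence u.
    have hs := hI _ hd
    rw [map_sub, h2 0 u hu, h2 1 w hw] at hs
    have h3 := add_mem hd hs
    have h4 : u - w + (superSign 1 0 • u - superSign 1 1 • w) = algebraMap F L.Env 2 * u := by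
      rw [show superSign 1 0 = 1 by decide, show superSign 1 1 = -1 by decide, ← Algebra.smul_def,
        two_smul]
      module
    rw [h4] at h3
    have h5 := (L.leftIdeal a).smul_mem (algebraMap F L.Env 2⁻¹) h3
    rw [smul_eq_mul, ← mul_assoc, ← map_mul, inv_mul_cancel₀ two_ne_zero, map_one, one_mul] at h5
    exact (L.toInd_eq_zero_iff a u).mpr h5
  · rw [codisjoint_iff]
    refine L.ind_submodule_eq_top a _ (Submodule.mem_sup_left ⟨1, L.one_mem_envPart, rfl⟩) ?_
    have key : ∀ i, ∀ x ∈ L.part i, ∀ j, ∀ v ∈ L.indPart a j,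
        L.rep a x v ∈ L.indPart a 0 ⊔ L.indPart a 1 := by
      rintro i x hx j _ ⟨u, hu, rfl⟩
      have : L.rep a x (L.toInd a u) ∈ L.indPart a (i + j) := ⟨_, L.ι_mul_mem_envPart hx hu, rfl⟩
      rcases (i + j).eq_zero_or_one_of_two with h | h <;> rw [h] at this
      exacts [Submodule.mem_sup_left this, Submodule.mem_sup_right this]
    intro x v hv
    obtain ⟨x₀, hx₀, x₁, hx₁, rfl⟩ := Submodule.mem_sup.mp
      (show x ∈ L.part 0 ⊔ L.part 1 by rw [L.isCompl.sup_eq_top]; trivial)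
    obtain ⟨v₀, hv₀, v₁, hv₁, rfl⟩ := Submodule.mem_sup.mp hv
    simp only [map_add, LinearMap.add_apply]
    exact add_mem (add_mem (key _ _ hx₀ _ _ hv₀) (key _ _ hx₁ _ _ hv₀))
      (add_mem (key _ _ hx₀ _ _ hv₁) (key _ _ hx₁ _ _ hv₁))

theorem rep_hasParity {p i : ZMod 2} {x : g} (hx : x ∈ L.part p) {v : L.Ind a}
    (hv : v ∈ L.indPart a i) : L.rep a x v ∈ L.indPart a (p + i) := by
  obtain ⟨u, hu, rfl⟩ := hv
  exact ⟨_, L.ι_mul_mem_envPart hx hu, rfl⟩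

/-! ### The fields -/

section Rep

variable {V : Type*} [AddCommGroup V] [Module F V] (ρ : g →ₗ[F] Module.End F V)

/-- Each derivative raises the truncation bound by one. This makes closure under n-th products
usable on a single vector. -/
theorem derivSpan_rep_bound {v : V} (h : ∀ j, ∃ K : ℤ, ∀ n, K ≤ n → ρ (a j n) v = 0) {b : ℤ → g}
    (hb : b ∈ derivSpan F a) : ∃ K : ℤ, ∀ n, K ≤ n → ρ (b n) v = 0 := by
  induction hb using Submodule.span_induction with
  | mem b hb =>
    obtain ⟨⟨j, k⟩, rfl⟩ := hb
    induction k with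
    | zero => exact h j
    | succ k ih =>
      obtain ⟨K, hK⟩ := ih
      refine ⟨K + 1, fun n hn => ?_⟩
      simp only [Function.iterate_succ_apply'] at hK ⊢
      rw [dz, map_neg, map_zsmul, LinearMap.neg_apply, LinearMap.smul_apply, hK _ (by lia),
        smul_zero, neg_zero]
  | zero => exact ⟨0, fun n _ => by simp⟩
  | add b c _ _ hb hc =>
    obtain ⟨K, hK⟩ := hb
    obtain ⟨M, hM⟩ := hc
    exact ⟨max K M, fun n hn => by
      rw [Pi.add_apply, map_add, LinearMap.add_apply, hK n (by lia), hM n (by lia), add_zero]⟩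
  | smul c b _ hb =>
    obtain ⟨K, hK⟩ := hb
    exact ⟨K, fun n hn => by
      rw [Pi.smul_apply, map_smul, LinearMap.smul_apply, hK n hn, smul_zero]⟩

/-- In a module over a regular formal distribution Lie superalgebra that is generated by a vector
annihilated by all `aʲ₍ₙ₎`, `n ≥ 0`, the `aʲ(z)` act as quantum fields. -/
theorem isQuantumField_of_rep (ha : L.IsRegular a)
    (hρ : ∀ i j x y, x ∈ L.part i → y ∈ L.part j →
      ρ x * ρ y - superSign i j • (ρ y * ρ x) = ρ (L.bracket x y))
    {vac : V} (hvac : ∀ j n, 0 ≤ n → ρ (a j n) vac = 0)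
    (hgen : ∀ S : Submodule F V, vac ∈ S → (∀ j n, ∀ v ∈ S, ρ (a j n) v ∈ S) → S = ⊤) (j : J) :
    IsQuantumField fun n => ρ (a j n) := by
  let S : Submodule F V :=
    { carrier := {v | ∀ j, ∃ K : ℤ, ∀ n, K ≤ n → ρ (a j n) v = 0}
      add_mem' := fun {u v} hu hv j => by
        obtain ⟨K, hK⟩ := hu j
        obtain ⟨M, hM⟩ := hv j
        exact ⟨max K M, fun n hn => by rw [map_add, hK n (by lia), hM n (by lia), add_zero]⟩
      zero_mem' := fun j => ⟨0, fun n _ => map_zero _⟩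
      smul_mem' := fun c v hv j => by
        obtain ⟨K, hK⟩ := hv j
        exact ⟨K, fun n hn => by rw [map_smul, hK n hn, smul_zero]⟩ }
  have hS : S = ⊤ := by
    refine hgen S (fun j => ⟨0, hvac j⟩) fun i n v hv j => ?_
    obtain ⟨p, hp⟩ := ha.homogeneous j
    obtain ⟨q, hq⟩ := ha.homogeneous i
    obtain ⟨N, hN⟩ := ha.isLocal j i
    let φ : g →+ V := ((LinearMap.applyₗ (R := F) v) ∘ₗ ρ).toAddMonoidHom
    have e : ∀ k, (mulSub^[k] fun m n => φ (L.bracket (a j m) (a i n))) =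
        fun m n => φ (mulSub^[k] (fun m n => L.bracket (a j m) (a i n)) m n) :=
      fun k => mulSub_iterate_map φ k _
    -- The residues are the n-th products of aʲ and aⁱ, which regularity places in the derivative
    -- span; they are thus truncated on v.
    obtain ⟨K, hK⟩ := exists_bound_of_residues
      (c := fun m n => φ (L.bracket (a j m) (a i n))) (N := N)
      (by rw [e, hN]; ext m n; simp) (fun k => by
        rw [e]
        exact derivSpan_rep_bound ρ hv (ha.nthProduct_mem k _ _
          (Submodule.subset_span ⟨(j, 0), rfl⟩) (Submodule.subset_span ⟨(i, 0), rfl⟩)))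
    obtain ⟨M, hM⟩ := hv j
    -- The bound K - n kills the bracket term, M kills aʲ₍ₘ₎v, and 0 is needed because the bound on
    -- the bracket holds for nonnegative m only.
    refine ⟨max (max (K - n) M) 0, fun m hm => ?_⟩
    have h1 := LinearMap.congr_fun (hρ _ _ _ _ (hp m) (hq n)) v
    have h2 : ρ (L.bracket (a j m) (a i n)) v = 0 := by
      have := hK m.toNat n (by lia)
      rwa [Int.toNat_of_nonneg (by lia)] at this
    rw [h2, LinearMap.sub_apply, LinearMap.smul_apply, Module.End.mul_apply,
      Module.End.mul_apply, hM m (by lia), map_zero, smul_zero, sub_zero] at h1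
    exact h1
  intro v
  have hv : v ∈ S := by rw [hS]; trivial
  exact hv j

theorem isLocalPair_of_rep (ha : L.IsFormalDistribution a)
    (hρ : ∀ i j x y, x ∈ L.part i → y ∈ L.part j →
      ρ x * ρ y - superSign i j • (ρ y * ρ x) = ρ (L.bracket x y))
    {part : ZMod 2 → Submodule F V}
    (hpart : ∀ p i, ∀ x ∈ L.part p, ∀ v ∈ part i, ρ x v ∈ part (p + i)) (i j : J) :
    IsLocalPair part (fun n => ρ (a i n)) (fun n => ρ (a j n)) := by
  obtain ⟨p, hp⟩ := ha.homogeneous i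
  obtain ⟨q, hq⟩ := ha.homogeneous j
  have hl : IsSignedLocal (superSign p q) (fun n => ρ (a i n)) (fun n => ρ (a j n)) := by
    unfold IsSignedLocal
    simp only [hρ _ _ _ _ (hp _) (hq _)]
    exact (ha.isLocal i j).map ρ.toAddMonoidHom
  have h := isLocalPair_of_hasParity (part := part) (B := fun n => ρ (a j n)) (q := q)
    (hasParity_single (p := p) (A := fun n => ρ (a i n)) fun n r v hv => hpart _ _ _ (hp n) v hv)
    (fun n r v hv => hpart _ _ _ (hq n) v hv) (fun r => by
      by_cases hr : r = p
      · subst hr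
        rwa [Pi.single_eq_same]
      · rw [Pi.single_eq_of_ne hr]
        exact isSignedLocal_zero_left)
  rwa [single_zero_add_single_one] at h

theorem isTranslationCovariant_of_rep {T : g →ₗ[F] g} (hT : L.IsTranslation a T)
    {T' : Module.End F V} (h : ∀ x v, T' (ρ x v) = ρ (T x) v + ρ x (T' v)) (j : J) :
    IsTranslationCovariant T' fun n => ρ (a j n) := by
  ext n v
  have h1 := congrFun (hT.map_coeff j) n
  beta_reduce at h1
  rw [LinearMap.sub_apply, Module.End.mul_apply, Module.End.mul_apply, h, h1,
    add_sub_cancel_right, dz, dz, map_neg, map_zsmul]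

theorem span_eq_top_of_rep {vac : V}
    (hgen : ∀ S : Submodule F V, vac ∈ S → (∀ j n, ∀ v ∈ S, ρ (a j n) v ∈ S) → S = ⊤) :
    Submodule.span F (Set.range fun l : List (J × ℤ) =>
      (l.map fun q => ρ (a q.1 q.2)).prod vac) = ⊤ := by
  refine hgen _ (Submodule.subset_span ⟨[], by simp⟩) fun j n v hv => ?_
  induction hv using Submodule.span_induction with
  | mem v hv =>
    obtain ⟨l, rfl⟩ := hv
    exact Submodule.subset_span ⟨(j, n) :: l, by simp⟩
  | zero => rw [map_zero]; exact zero_mem _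
  | add u v _ _ hu hv => rw [map_add]; exact add_mem hu hv
  | smul c v _ hv => rw [map_smul]; exact Submodule.smul_mem _ c hv

end Rep

/-- A subspace of `V` that contains `|0⟩` and is stable under the coefficients of the fields
`π(aʲ(z))` is everything. -/
theorem ind_submodule_eq_top_of_field (ha : L.IsFormalDistribution a) (S : Submodule F (L.Ind a))
    (h1 : L.vacuum a ∈ S) (h : ∀ j n, ∀ v ∈ S, L.field a j n v ∈ S) : S = ⊤ := by
  refine L.ind_submodule_eq_top a S h1 fun x v hv => ?_
  have hx : x ∈ Submodule.span F (Set.range fun q : J × ℤ => a q.1 q.2) := by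
    rw [ha.span_eq_top]; trivial
  induction hx using Submodule.span_induction with
  | mem x hx =>
    obtain ⟨q, rfl⟩ := hx
    exact h q.1 q.2 v hv
  | zero => simp
  | add x y _ _ hx hy => rw [map_add]; exact add_mem hx hy
  | smul c x _ hx => rw [map_smul]; exact Submodule.smul_mem _ c hx

theorem isQuantumField_field (ha : L.IsRegular a) (j : J) : IsQuantumField (L.field a j) :=
  L.isQuantumField_of_rep (L.rep a) ha (fun _ _ _ _ hx hy => L.rep_bracket a hx hy)
    (fun j n hn => L.rep_vacuum_of_mem a (Submodule.subset_span
      ⟨(j, n.toNat), by simp [Int.toNat_of_nonneg hn]⟩))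
    (fun S h1 h => L.ind_submodule_eq_top_of_field ha.toIsFormalDistribution S h1 h) j

theorem isPreVertex_ind [CharZero F] (ha : L.IsRegular a) {T : g →ₗ[F] g}
    (hT : L.IsTranslation a T) :
    IsPreVertex (L.indPart a) (L.vacuum a) (L.indT hT) (L.field a) where
  isCompl := L.indPart_isCompl ha.homogeneous
  vac_ne_zero := L.vacuum_ne_zero a
  vac_even := ⟨1, L.one_mem_envPart, rfl⟩
  T_even := by
    rintro i _ ⟨u, hu, rfl⟩
    rw [indT_toInd]
    exact ⟨_, L.envDerivation_mem_envPart hT.isDerivation hu, rfl⟩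
  homogeneous j := by
    obtain ⟨p, hp⟩ := ha.homogeneous j
    exact ⟨p, fun n i v hv => L.rep_hasParity (hp n) hv⟩
  isQuantumField := L.isQuantumField_field ha
  T_vac := by
    have h1 : L.envDerivation T hT.isDerivation 1 = 0 := by
      have := L.envDerivation_mul T hT.isDerivation 1 1
      simpa using this
    rw [vacuum, indT_toInd, h1, map_zero]
  translation := L.isTranslationCovariant_of_rep (L.rep a) hT fun x v => by
    obtain ⟨u, rfl⟩ := L.toInd_surjective a v
    rw [rep_toInd, indT_toInd, envDerivation_mul, envDerivation_ι, map_add]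
    rfl
  isLocal := L.isLocalPair_of_rep (L.rep a) ha.toIsFormalDistribution
    (fun _ _ _ _ hx hy => L.rep_bracket a hx hy) fun _ _ _ hx _ hv => L.rep_hasParity hx hv
  completeness := span_eq_top_of_rep (L.rep a)
    fun S h1 h => L.ind_submodule_eq_top_of_field ha.toIsFormalDistribution S h1 h

end

end LieSuperalgebra

theorem theorem2p1 {F g J : Type*} [Field F] [CharZero F] [AddCommGroup g] [Module F g]
    (L : LieSuperalgebra F g) (a : J → ℤ → g) (ha : L.IsRegular a)
    (T : g →ₗ[F] g) (hT : L.IsTranslation a T) :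
    (∀ j, VertexSuperalgebra.IsQuantumField (L.field a j)) ∧
    VertexSuperalgebra.IsPreVertex (L.indPart a) (L.vacuum a) (L.indT hT) (L.field a) ∧
    ∃ Y : L.Ind a →ₗ[F] ℤ → Module.End F (L.Ind a),
      VertexSuperalgebra.IsVertexSuperalgebra (L.indPart a) (L.vacuum a) (L.indT hT) Y ∧
      Set.range Y = VertexSuperalgebra.Fmax (L.indPart a) (L.indT hT) (L.field a) ∧
      ∀ j, Y (L.field a j (-1) (L.vacuum a)) = L.field a j := by
  have hV := L.isPreVertex_ind ha hT
  choose π hπ using hV.homogeneous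
  exact ⟨hV.isQuantumField, hV, VertexSuperalgebra.exists_isVertexSuperalgebra hV hπ⟩
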